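/- **Setting.** Let $K,L,A,B$ be non-empty finite sets, $M:K\times L\times A\times B\to\mathbb R$, $T\ge 1$, $p\in\Delta(K)$, $q\in\Delta(L)$. In the zero-sum game $\Gamma_T(p,q)$ types $k\sim p$ and $l\sim q$ are drawn independently and told to player 1 and player 2, respectively; at each stage $t=1,\dots,T$, knowing the past actions $h_t^A=(a_1,\dots,a_{t-1})$, $h_t^B=(b_1,\dots,b_{t-1})$ of both, the players simultaneously choose $a_t\in A$, $b_t\in B$ by behavior strategies $\sigma_t(k,h_t^A,h_t^B)\in\Delta(A)$, $\tau_t(l,h_t^A,h_t^B)\in\Delta(B)$. Player 1 maximizes and player 2 minimizes $\gamma_T(p,q,\sigma,\tau)=\mathbb E_{p,q,\sigma,\tau}\big[\sum_{t=1}^T M(k,l,a_t,b_t)\big]$. A security strategy is a strategy attaining the player's security level ($\max_\sigma\min_\tau\gamma_T$, respectively $\min_\tau\max_\sigma\gamma_T$). In the type 1 dual game with parameters $(\mu,q)$, $\mu\in\mathbb R^K$, player 1 also chooses the distribution of $k$, and the payoff is $\mathbb E[\mu^k+\sum_t M(k,l,a_t,b_t)]$; in the type 2 dual game with parameters $(p,\nu)$,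 $\nu\in\mathbb R^L$, player 2 also chooses the distribution of $l$, and the payoff is $\mathbb E[\nu^l+\sum_t M(k,l,a_t,b_t)]$. These three games have values; those of the dual games are denoted $\tilde V^1_T(\mu,q)$ and $\tilde V^2_T(p,\nu)$. The realization plans of $\sigma$ and $\tau$ are $x^{a_t}_{k,h_t^A,h_t^B}=p^k\prod_{s=1}^t\sigma_s^{a_s}(k,h_s^A,h_s^B)$ and $y^{b_t}_{l,h_t^A,h_t^B}=q^l\prod_{s=1}^t\tau_s^{b_s}(l,h_s^A,h_s^B)$, $0\le t\le T$ (for $t=0$: $p^k$ and $q^l$). The weighted future security payoffs, for $0\le t\le T-1$ with $h_{t+1}^A=(h_t^A,a_t)$, $h_{t+1}^B=(h_t^B,b_t)$, are $$u^{a_t,b_t}_{l,h_t^A,h_t^B}(x)=\min_{\tau_{t+1:T}(l)}\sum_{k} x^{a_t}_{k,h_t^A,h_t^B}\,\mathbb E\Big[\sum_{s=t+1}^T M(k,l,a_s,b_s)\,\Big|\,k,l,h_{t+1}^A,h_{t+1}^B\Big],$$ $$w^{a_t,b_t}_{k,h_t^A,h_t^B}(y)=\max_{\sigma_{t+1:T}(k)}\sum_{l}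 y^{b_t}_{l,h_t^A,h_t^B}\,\mathbb E\Big[\sum_{s=t+1}^T M(k,l,a_s,b_s)\,\Big|\,k,l,h_{t+1}^A,h_{t+1}^B\Big],$$ where conditional expectations are taken with respect to the continuation strategies; for $t=0$ they are denoted $u_{l,0}(x)$, $w_{k,0}(y)$. Player 2's linear program: minimize $\sum_k p^k w_{k,0}$ over $y\ge0$ with $\sum_{b_t} y^{b_t}_{l,h_t^A,h_t^B}=y^{b_{t-1}}_{l,h_{t-1}^A,h_{t-1}^B}$ for $1\le t\le T$ (the right-hand side being $q^l$ for $t=1$), and real $w$, subject to, for all $0\le t\le T-1$, all $k\in K$, all histories and all $a\in A$, $$\sum_{l,b}M(k,l,a,b)\,y^{b}_{l,h_{t+1}^A,h_{t+1}^B}+\sum_{b} w^{a,b}_{k,h_{t+1}^A,h_{t+1}^B}\le w^{a_t,b_t}_{k,h_t^A,h_t^B},$$ where the right-hand side is $w_{k,0}$ for $t=0$, and $w_{k,h_T^A,h_T^B}=0$. Player 1's linear program: maximize $\sum_l q^l u_{l,0}$ over $x\ge0$ with $\sum_{a_t} x^{a_t}_{k,h_t^A,h_t^B}=x^{a_{t-1}}_{k,h_{t-1}^A,h_{t-1}^B}$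 ($p^k$ for $t=1$), and real $u$, subject to, for all $0\le t\le T-1$, all $l\in L$, all histories and all $b\in B$, $\sum_{k,a}M(k,l,a,b)\,x^{a}_{k,h_{t+1}^A,h_{t+1}^B}+\sum_{a}u^{a,b}_{l,h_{t+1}^A,h_{t+1}^B}\ge u^{a_t,b_t}_{l,h_t^A,h_t^B}$ ($u_{l,0}$ for $t=0$), with $u_{l,h_T^A,h_T^B}=0$. **Lemma.** 1. Let $\tau^*$ be a security strategy of player 2 in $\Gamma_T(p,q)$, with realization plan $y^*$. Then $\mu^{*k}=-w_{k,0}(y^*)$, $k\in K$, is an optimal solution of $\min_{\mu\in\mathbb R^{K}}\{\tilde V^1_T(\mu,q)-p^{\mathsf T}\mu\}$, and $\tilde V^1_T(\mu^*,q)=0$. Moreover, $y^*$ together with $w(y^*)$ and $w_{:,0}(y^*)$ is an optimal solution of player 2's linear program. Conversely, if $(y,w,w_{:,0})$ is any optimal solution of that program, then $y$ is the realization plan of a security strategy of player 2, $w_{:,0}=w_{:,0}(y)$ if all $p^k>0$, and $-w_{:,0}$ is an optimal solution of the above minimization problem, with $\tilde V^1_T(-w_{:,0},q)=0$. 2. Let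 $\sigma^*$ be a security strategy of player 1 in $\Gamma_T(p,q)$, with realization plan $x^*$. Then $\nu^{*l}=-u_{l,0}(x^*)$, $l\in L$, is an optimal solution of $\max_{\nu\in\mathbb R^{L}}\{\tilde V^2_T(p,\nu)-q^{\mathsf T}\nu\}$, and $\tilde V^2_T(p,\nu^*)=0$. Moreover, $x^*$ together with $u(x^*)$ and $u_{:,0}(x^*)$ is an optimal solution of player 1's linear program. Conversely, if $(x,u,u_{:,0})$ is any optimal solution of that program, then $x$ is the realization plan of a security strategy of player 1, $u_{:,0}=u_{:,0}(x)$ if all $q^l>0$, and $-u_{:,0}$ is an optimal solution of the above maximization problem, with $\tilde V^2_T(p,-u_{:,0})=0$. -/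

import Mathlib

namespace BayesGame

/-! ### Zero-sum games: security levels, value, security strategies

`g s t` is the payoff of player 1 (the maximizer) when player 1 uses `s` and player 2 uses `t`. -/

section ZeroSum

variable {S S' : Type*}

/-- `v = max_s min_t g s t`, both extrema being attained: the security level of player 1. -/
def IsMaximin (g : S → S' → ℝ) (v : ℝ) : Prop :=
  IsGreatest {m : ℝ | ∃ s, IsLeast (Set.range fun t => g s t) m} v

/-- `v = min_t max_s g s t`, both extrema being attained: the security level of player 2. -/
def IsMinimax (g : S → S' → ℝ) (v : ℝ) : Prop :=
  IsLeast {m : ℝ | ∃ t, IsGreatest (Set.range fun s => g s t) m} v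

/-- `v` is the value of the game: the two security levels exist and are both equal to `v`. -/
def IsValue (g : S → S' → ℝ) (v : ℝ) : Prop :=
  IsMaximin g v ∧ IsMinimax g v

/-- The value of a game, as a number (meaningful when `IsValue g (gameValue g)`). -/
noncomputable def gameValue (g : S → S' → ℝ) : ℝ :=
  ⨆ s, ⨅ t, g s t

/-- A strategy of player 1 that achieves the security level of player 1. -/
def IsSecurity₁ (g : S → S' → ℝ) (s : S) : Prop :=
  ∃ v, IsMaximin g v ∧ IsLeast (Set.range fun t => g s t) v

/-- A strategy of player 2 that achieves the security level of player 2. -/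
def IsSecurity₂ (g : S → S' → ℝ) (t : S') : Prop :=
  ∃ v, IsMinimax g v ∧ IsGreatest (Set.range fun s => g s t) v

end ZeroSum

/-! ### The repeated Bayesian game

`K`, `L` are the type sets and `A`, `B` the action sets of players 1 and 2; there are `T` stages,
numbered `0, …, T - 1`, so that stage `t` is preceded by action histories `Fin t → A` and
`Fin t → B`. -/

/-- The strategy of one type of a player: at each stage `t`, a map from the action histories of
both players before stage `t` to distributions over the player's own action set `C`. -/
abbrev TypeStrategy (T : ℕ) (A B C : Type*) [Fintype C] :=
  (t : Fin T) → (Fin t → A) → (Fin t → B) → stdSimplex ℝ C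

/-- A behavior strategy of a player with type set `Θ` and action set `C`. -/
abbrev Strategy (T : ℕ) (Θ A B C : Type*) [Fintype C] :=
  Θ → TypeStrategy T A B C

/-- The first `n` terms of a sequence of length `N`. -/
def pre {N : ℕ} {C : Type*} (c : Fin N → C) (n : ℕ) (hn : n ≤ N) : Fin n → C :=
  fun i => c ⟨i, i.2.trans_le hn⟩

section Game

variable {T : ℕ} {K L A B : Type*} [Fintype K] [Fintype L] [Fintype A] [Fintype B]

/-- The conditional probability that the play goes on as in `(a, b)` from stage `n` on, given that
it agrees with `(a, b)` before stage `n`, under `s` (player 1) and `t` (player 2). -/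
def futureProb (n : ℕ) (s : TypeStrategy T A B A) (t : TypeStrategy T A B B)
    (a : Fin T → A) (b : Fin T → B) : ℝ :=
  ∏ r ∈ Finset.univ.filter (fun r : Fin T => n ≤ r),
    ((s r (pre a r r.2.le) (pre b r r.2.le)).1 (a r) *
      (t r (pre a r r.2.le) (pre b r r.2.le)).1 (b r))

/-- The probability distribution `P_{p,q,σ,τ}` on the set `K × L × (A × B)^T` of plays. -/
def playProb (p : K → ℝ) (q : L → ℝ) (σ : Strategy T K A B A) (τ : Strategy T L A B B)
    (k : K) (l : L) (a : Fin T → A) (b : Fin T → B) : ℝ :=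
  p k * q l * futureProb 0 (σ k) (τ l) a b

/-- The expectation `𝔼_{p,q,σ,τ}`. -/
noncomputable def expectation (p : K → ℝ) (q : L → ℝ) (σ : Strategy T K A B A)
    (τ : Strategy T L A B B) (f : K → L → (Fin T → A) → (Fin T → B) → ℝ) : ℝ :=
  ∑ k, ∑ l, ∑ a : Fin T → A, ∑ b : Fin T → B, playProb p q σ τ k l a b * f k l a b

/-- The payoff `γ_T(p, q, σ, τ)` of the game `Γ_T(p, q)`. -/
noncomputable def payoff (M : K → L → A → B → ℝ) (p : K → ℝ) (q : L → ℝ)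
    (σ : Strategy T K A B A) (τ : Strategy T L A B B) : ℝ :=
  expectation p q σ τ fun k l a b => ∑ t, M k l (a t) (b t)

/-- The payoff of the type 1 dual game with initial regret `μ`: player 1 also chooses the
distribution `s.1` of his own type. -/
noncomputable def dualPayoff₁ (M : K → L → A → B → ℝ) (μ : K → ℝ) (q : L → ℝ)
    (s : stdSimplex ℝ K × Strategy T K A B A) (τ : Strategy T L A B B) : ℝ :=
  expectation s.1.1 q s.2 τ fun k l a b => μ k + ∑ t, M k l (a t) (b t)

/-- The payoff of the type 2 dual game with initial regret `ν`: player 2 also chooses the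
distribution `s.1` of his own type. -/
noncomputable def dualPayoff₂ (M : K → L → A → B → ℝ) (p : K → ℝ) (ν : L → ℝ)
    (σ : Strategy T K A B A) (s : stdSimplex ℝ L × Strategy T L A B B) : ℝ :=
  expectation p s.1.1 σ s.2 fun k l a b => ν l + ∑ t, M k l (a t) (b t)

/-- The value `Ṽ¹_T(μ, q)` of the type 1 dual game. -/
noncomputable def dualValue₁ (T : ℕ) (M : K → L → A → B → ℝ) (μ : K → ℝ) (q : L → ℝ) : ℝ :=
  gameValue (dualPayoff₁ (T := T) M μ q)

/-- The value `Ṽ²_T(p, ν)` of the type 2 dual game. -/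
noncomputable def dualValue₂ (T : ℕ) (M : K → L → A → B → ℝ) (p : K → ℝ) (ν : L → ℝ) : ℝ :=
  gameValue (dualPayoff₂ (T := T) M p ν)

/-! ### Realization plans -/

/-- The product of `p k` and the probabilities with which type `k` of player 1 plays his actions of
the history `(hA, hB)` of length `n`, that is, player 1's realization plan
`p^k ∏_{s ≤ n} σ_s^{a_s}` at the last action of that history. -/
def reach₁ (p : K → ℝ) (σ : Strategy T K A B A) (n : Fin T) (k : K)
    (hA : Fin n → A) (hB : Fin n → B) : ℝ :=
  p k * ∏ s : Fin n,
    (σ k ⟨s, s.2.trans n.2⟩ (pre hA s s.2.le) (pre hB s s.2.le)).1 (hA s)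

/-- The analogue `q^l ∏_{s ≤ n} τ_s^{b_s}` for player 2. -/
def reach₂ (q : L → ℝ) (τ : Strategy T L A B B) (n : Fin T) (l : L)
    (hA : Fin n → A) (hB : Fin n → B) : ℝ :=
  q l * ∏ s : Fin n,
    (τ l ⟨s, s.2.trans n.2⟩ (pre hA s s.2.le) (pre hB s s.2.le)).1 (hB s)

/-- Families of reals indexed by a stage, a type, the action histories before that stage, and an
action at that stage: the space that contains the realization plans. -/
abbrev PlanSpace (T : ℕ) (Θ A B C : Type*) :=
  (n : Fin T) → Θ → (Fin n → A) → (Fin n → B) → C → ℝ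

/-- Player 1's realization plan `x` of the strategy `σ`. -/
def plan₁ (p : K → ℝ) (σ : Strategy T K A B A) : PlanSpace T K A B A :=
  fun n k hA hB a => reach₁ p σ n k hA hB * (σ k n hA hB).1 a

/-- Player 2's realization plan `y` of the strategy `τ`. -/
def plan₂ (q : L → ℝ) (τ : Strategy T L A B B) : PlanSpace T L A B B :=
  fun n l hA hB b => reach₂ q τ n l hA hB * (τ l n hA hB).1 b

/-- The polyhedron `X`: nonnegative `x` whose sum over the actions at a stage is the entry of the
preceding stage (`p k` at the first stage). -/
def planSet₁ (p : K → ℝ) : Set (PlanSpace T K A B A) :=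
  {x | (∀ n k hA hB a, 0 ≤ x n k hA hB a) ∧
    (∀ (h : 0 < T) (k : K), ∑ a, x ⟨0, h⟩ k Fin.elim0 Fin.elim0 a = p k) ∧
    ∀ (n : ℕ) (h : n + 1 < T) (k : K) (hA : Fin n → A) (hB : Fin n → B) (a : A) (b : B),
      ∑ a', x ⟨n + 1, h⟩ k (Fin.snoc hA a) (Fin.snoc hB b) a' =
        x ⟨n, Nat.lt_of_succ_lt h⟩ k hA hB a}

/-- The polyhedron `Y`. -/
def planSet₂ (q : L → ℝ) : Set (PlanSpace T L A B B) :=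
  {y | (∀ n l hA hB b, 0 ≤ y n l hA hB b) ∧
    (∀ (h : 0 < T) (l : L), ∑ b, y ⟨0, h⟩ l Fin.elim0 Fin.elim0 b = q l) ∧
    ∀ (n : ℕ) (h : n + 1 < T) (l : L) (hA : Fin n → A) (hB : Fin n → B) (a : A) (b : B),
      ∑ b', y ⟨n + 1, h⟩ l (Fin.snoc hA a) (Fin.snoc hB b) b' =
        y ⟨n, Nat.lt_of_succ_lt h⟩ l hA hB b}

/-! ### Weighted future security payoffs -/

open Classical in
/-- The conditional expectation of the sum of the payoffs from stage `n` on, given that the history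
before stage `n` is `(hA, hB)`, for the stage payoff `m`, when the players' types use `s` and `t`
(only their components from stage `n` on matter). -/
noncomputable def futurePayoff (m : A → B → ℝ) (n : Fin T) (hA : Fin n → A) (hB : Fin n → B)
    (s : TypeStrategy T A B A) (t : TypeStrategy T A B B) : ℝ :=
  ∑ a : Fin T → A, ∑ b : Fin T → B,
    if pre a n n.2.le = hA ∧ pre b n n.2.le = hB then
      futureProb n s t a b *
        ∑ r ∈ Finset.univ.filter (fun r : Fin T => (n : ℕ) ≤ r), m (a r) (b r)
    else 0

/-- Families of reals indexed by a type and a pair of action histories of the same length `< T`. -/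
abbrev SecuritySpace (T : ℕ) (Θ A B : Type*) :=
  (n : Fin T) → Θ → (Fin n → A) → (Fin n → B) → ℝ

/-- The weighted future security payoff `u_l(x)` after the history `(hA, hB)`, for the realization
plan `x` of `σ` (with prior `p`): a minimum over the continuation strategies of type `l`. -/
noncomputable def futureSecurity₁ (M : K → L → A → B → ℝ) (p : K → ℝ)
    (σ : Strategy T K A B A) : SecuritySpace T L A B :=
  fun n l hA hB => ⨅ t : TypeStrategy T A B B,
    ∑ k, reach₁ p σ n k hA hB * futurePayoff (M k l) n hA hB (σ k) t

/-- The weighted future security payoff `w_k(y)` after the history `(hA, hB)`, for the realization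
plan `y` of `τ` (with prior `q`): a maximum over the continuation strategies of type `k`. -/
noncomputable def futureSecurity₂ (M : K → L → A → B → ℝ) (q : L → ℝ)
    (τ : Strategy T L A B B) : SecuritySpace T K A B :=
  fun n k hA hB => ⨆ s : TypeStrategy T A B A,
    ∑ l, reach₂ q τ n l hA hB * futurePayoff (M k l) n hA hB s (τ l)

/-- The components `u_{l,0}` or `w_{k,0}` at the empty history. -/
def initial {Θ : Type*} (hT : 0 < T) (w : SecuritySpace T Θ A B) (θ : Θ) : ℝ :=
  w ⟨0, hT⟩ θ Fin.elim0 Fin.elim0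

/-- `w` at histories of length `n + 1`, with the convention that it vanishes at length `T`. -/
def next {Θ : Type*} (w : SecuritySpace T Θ A B) (n : Fin T) (θ : Θ)
    (hA : Fin (n + 1) → A) (hB : Fin (n + 1) → B) : ℝ :=
  if h : (n : ℕ) + 1 < T then w ⟨n + 1, h⟩ θ hA hB else 0

/-! ### The linear programs -/

/-- The constraints of player 1's linear program, in the variables `x` and `u` (where `u` includes
the variables `u_{l,0}`, its components at the empty history). -/
def Feasible₁ (M : K → L → A → B → ℝ) (p : K → ℝ)
    (x : PlanSpace T K A B A) (u : SecuritySpace T L A B) : Prop :=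
  x ∈ planSet₁ p ∧
    ∀ (n : Fin T) (l : L) (hA : Fin n → A) (hB : Fin n → B) (b : B),
      u n l hA hB ≤ ∑ k, ∑ a, M k l a b * x n k hA hB a +
        ∑ a, next u n l (Fin.snoc hA a) (Fin.snoc hB b)

/-- The constraints of player 2's linear program, in the variables `y` and `w` (where `w` includes
the variables `w_{k,0}`, its components at the empty history). -/
def Feasible₂ (M : K → L → A → B → ℝ) (q : L → ℝ)
    (y : PlanSpace T L A B B) (w : SecuritySpace T K A B) : Prop :=
  y ∈ planSet₂ q ∧
    ∀ (n : Fin T) (k : K) (hA : Fin n → A) (hB : Fin n → B) (a : A),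
      ∑ l, ∑ b, M k l a b * y n l hA hB b +
        ∑ b, next w n k (Fin.snoc hA a) (Fin.snoc hB b) ≤ w n k hA hB

/-- `(x, u)` is an optimal solution of player 1's linear program: maximize `∑ q^l u_{l,0}`. -/
def IsOptimal₁ (hT : 0 < T) (M : K → L → A → B → ℝ) (p : K → ℝ) (q : L → ℝ)
    (x : PlanSpace T K A B A) (u : SecuritySpace T L A B) : Prop :=
  Feasible₁ M p x u ∧ ∀ x' u', Feasible₁ M p x' u' →
    ∑ l, q l * initial hT u' l ≤ ∑ l, q l * initial hT u l

/-- `(y, w)` is an optimal solution of player 2's linear program: minimize `∑ p^k w_{k,0}`. -/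
def IsOptimal₂ (hT : 0 < T) (M : K → L → A → B → ℝ) (p : K → ℝ) (q : L → ℝ)
    (y : PlanSpace T L A B B) (w : SecuritySpace T K A B) : Prop :=
  Feasible₂ M q y w ∧ ∀ y' w', Feasible₂ M q y' w' →
    ∑ k, p k * initial hT w k ≤ ∑ k, p k * initial hT w' k

end Game

/-- `μ` is an optimal solution of `min_{μ ∈ ℝ^K} {Ṽ¹_T(μ, q) - pᵀ μ}`. -/
def IsInitialRegret₁ {K L A B : Type*} [Fintype K] [Fintype L] [Fintype A] [Fintype B]
    (T : ℕ) (M : K → L → A → B → ℝ) (p : K → ℝ) (q : L → ℝ) (μ : K → ℝ) : Prop :=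
  IsMinOn (fun μ' : K → ℝ => dualValue₁ T M μ' q - ∑ k, p k * μ' k) Set.univ μ

/-- `ν` is an optimal solution of `max_{ν ∈ ℝ^L} {Ṽ²_T(p, ν) - qᵀ ν}`. -/
def IsInitialRegret₂ {K L A B : Type*} [Fintype K] [Fintype L] [Fintype A] [Fintype B]
    (T : ℕ) (M : K → L → A → B → ℝ) (p : K → ℝ) (q : L → ℝ) (ν : L → ℝ) : Prop :=
  IsMaxOn (fun ν' : L → ℝ => dualValue₂ T M p ν' - ∑ l, q l * ν' l) Set.univ ν

end BayesGame

/-!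
# Initial regrets, security strategies and linear programs of a repeated Bayesian game

*Best replies.* Against a fixed strategy `τ` of player 2, player 1's types solve separate finite
dynamic programs. By the tower property (`condExpect_step`), the payoff that type `k` collects after
a history, weighted by the probabilities with which `τ` realizes that history, satisfies a one-step
recursion in which `τ` enters only through its realization plan `y`. Backward induction then gives
two facts. The future security payoffs `w(y)` solve Bellman's equation and are attained by one
strategy at all histories (`futureSecurity₂_eq_bellman`). The constraints of player 2's linear
program are the inequalities `≥` of that equation, so `w(y)` is the least feasible `w` for `y`
(`feasible₂_plan₂`, `futureSecurity₂_le`). Since the points of `planSet₂ q` are exactly the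
realization plans (`plan₂_strategyOfPlan`), the linear program minimizes `∑ p^k w_{k,0}(y)` over the
strategies of player 2, and this is the security level of player 2 (`isSecurity₂_iff`).

*Values.* The payoff is bilinear in the two realization plans (`payoff_eq_sum_stagePayoff`), and the
sets of plans are convex and compact, also when a player chooses the distribution of his own type.
Sion's theorem therefore gives the values. A dual game is covered by the same computation, because
its initial regret can be spread evenly over the stages (`dualPayoff₁_eq_payoff`).

*Regrets.* Let `w₀` be `w_{:,0}(y*)` for a security strategy, or the initial component of an optimal
solution of the linear program. In the type 1 dual game with regret `-w₀`, the strategy with plan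
`y*` holds every type of player 1 to at most `0`. Conversely, in the dual game with any regret `μ`,
player 1 can draw his type from `p` and guarantee `∑ p^k (μ^k + w₀^k)`, as no strategy of player 2
has an average `∑ p^k w_{k,0}` below that of `w₀`. The first bound and the second one for `μ = -w₀`
show that the dual value is `0`; the second one for all `μ` shows that `-w₀` is optimal
(`dualValue₁_eq_zero_and_isInitialRegret₁`).

*Player 1.* Exchanging the roles of the players and negating the stage payoffs turns each assertion
about player 1 into the one about player 2 (`futureSecurity₂_exchange`, `isOptimal₂_exchange`,
`dualValue₂_exchange`).
-/

namespace BayesGame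

/-! ### Conditional expectations given a history -/

section Histories

variable {T : ℕ} {K L A B : Type*}

theorem pre_snoc {n m : ℕ} {C : Type*} (h : Fin n → C) (c : C) (hm : m ≤ n) :
    pre (Fin.snoc (α := fun _ => C) h c) m (hm.trans n.le_succ) = pre h m hm := by
  funext i
  have : (⟨i, i.2.trans_le (hm.trans n.le_succ)⟩ : Fin (n + 1)) =
      Fin.castSucc ⟨i, i.2.trans_le hm⟩ := rfl
  simp only [pre]
  rw [this, Fin.snoc_castSucc]

theorem pre_succ_eq_snoc_iff {C : Type*} (c : Fin T → C) {n : ℕ} (hn : n < T)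
    (h : Fin n → C) (x : C) :
    pre c (n + 1) hn = Fin.snoc (α := fun _ => C) h x ↔ pre c n hn.le = h ∧ c ⟨n, hn⟩ = x := by
  constructor
  · intro e
    refine ⟨?_, ?_⟩
    · funext i
      have := congrFun e i.castSucc
      rw [Fin.snoc_castSucc] at this
      exact this
    · have := congrFun e (Fin.last n)
      rw [Fin.snoc_last] at this
      exact this
  · rintro ⟨rfl, rfl⟩
    funext i
    refine Fin.lastCases ?_ (fun i => ?_) i
    · rw [Fin.snoc_last]; rfl
    · rw [Fin.snoc_castSucc]; rfl

theorem filter_stage_le_eq_insert {n : ℕ} (hn : n < T) :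
    Finset.univ.filter (fun r : Fin T => n ≤ r) =
      insert ⟨n, hn⟩ (Finset.univ.filter (fun r : Fin T => n + 1 ≤ r)) := by
  ext r
  simp only [Finset.mem_filter, Finset.mem_univ, true_and, Finset.mem_insert, Fin.ext_iff]
  omega

theorem sum_eq_sum_snoc {n : ℕ} {C : Type*} [Fintype C] (F : (Fin (n + 1) → C) → ℝ) :
    ∑ h, F h = ∑ h : Fin n → C, ∑ c, F (Fin.snoc h c) := by
  rw [← (Fin.snocEquiv fun _ => C).sum_comp, Fintype.sum_prod_type_right]
  rfl

variable [Fintype A] [Fintype B]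

open Classical in
/-- The conditional expectation of `f`, given that the play agrees with `(hA, hB)` before stage
`n`. The length `n = T` is allowed, so that recursions in `n` can start from complete plays. -/
noncomputable def condExpect (s : TypeStrategy T A B A) (t : TypeStrategy T A B B)
    (f : (Fin T → A) → (Fin T → B) → ℝ) (n : ℕ) (hn : n ≤ T)
    (hA : Fin n → A) (hB : Fin n → B) : ℝ :=
  ∑ a : Fin T → A, ∑ b : Fin T → B,
    if pre a n hn = hA ∧ pre b n hn = hB then futureProb n s t a b * f a b else 0

theorem futureProb_eq_mul (s : TypeStrategy T A B A) (t : TypeStrategy T A B B) {n : ℕ}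
    (hn : n < T) (a : Fin T → A) (b : Fin T → B) :
    futureProb n s t a b =
      ((s ⟨n, hn⟩ (pre a n hn.le) (pre b n hn.le)).1 (a ⟨n, hn⟩) *
        (t ⟨n, hn⟩ (pre a n hn.le) (pre b n hn.le)).1 (b ⟨n, hn⟩)) *
      futureProb (n + 1) s t a b := by
  unfold futureProb
  rw [filter_stage_le_eq_insert hn, Finset.prod_insert (by simp)]

theorem futureProb_length (s : TypeStrategy T A B A) (t : TypeStrategy T A B B)
    (a : Fin T → A) (b : Fin T → B) : futureProb T s t a b = 1 := by
  unfold futureProb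
  rw [Finset.filter_false_of_mem (fun r _ => not_le.2 r.2), Finset.prod_empty]

theorem condExpect_length (s : TypeStrategy T A B A) (t : TypeStrategy T A B B)
    (f : (Fin T → A) → (Fin T → B) → ℝ) (hA : Fin T → A) (hB : Fin T → B) :
    condExpect s t f T le_rfl hA hB = f hA hB := by
  classical
  simp only [condExpect]
  rw [Finset.sum_eq_single hA, Finset.sum_eq_single hB]
  · rw [if_pos ⟨rfl, rfl⟩, futureProb_length, one_mul]
  · intro b _ hb
    rw [if_neg]
    exact fun h => hb h.2
  · simp
  · intro a _ ha
    refine Finset.sum_eq_zero fun b _ => ?_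
    rw [if_neg]
    exact fun h => ha h.1
  · simp

/-- The tower property over the actions of stage `n`. -/
theorem condExpect_step (s : TypeStrategy T A B A) (t : TypeStrategy T A B B)
    (f : (Fin T → A) → (Fin T → B) → ℝ) {n : ℕ} (hn : n < T) (hA : Fin n → A) (hB : Fin n → B) :
    condExpect s t f n hn.le hA hB =
      ∑ α, ∑ β, (s ⟨n, hn⟩ hA hB).1 α * (t ⟨n, hn⟩ hA hB).1 β *
        condExpect s t f (n + 1) hn (Fin.snoc hA α) (Fin.snoc hB β) := by
  classical
  have key : ∀ (a : Fin T → A) (b : Fin T → B),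
      (if pre a n hn.le = hA ∧ pre b n hn.le = hB then futureProb n s t a b * f a b else 0) =
      ∑ α, ∑ β, (s ⟨n, hn⟩ hA hB).1 α * (t ⟨n, hn⟩ hA hB).1 β *
        if pre a (n + 1) hn = Fin.snoc (α := fun _ => A) hA α ∧
            pre b (n + 1) hn = Fin.snoc (α := fun _ => B) hB β then
          futureProb (n + 1) s t a b * f a b else 0 := by
    intro a b
    simp only [pre_succ_eq_snoc_iff]
    rw [Finset.sum_eq_single (a ⟨n, hn⟩), Finset.sum_eq_single (b ⟨n, hn⟩)]
    · by_cases h : pre a n hn.le = hA ∧ pre b n hn.le = hB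
      · obtain ⟨rfl, rfl⟩ := h
        simp only [and_self, if_true]
        rw [futureProb_eq_mul s t hn, mul_assoc]
      · rw [if_neg h, if_neg (fun h' => h ⟨h'.1.1, h'.2.1⟩), mul_zero]
    · intro β _ hβ
      rw [if_neg (fun h => hβ h.2.2.symm), mul_zero]
    · simp
    · intro α _ hα
      refine Finset.sum_eq_zero fun β _ => ?_
      rw [if_neg (fun h => hα h.1.2.symm), mul_zero]
    · simp
  simp only [condExpect, key, Finset.mul_sum]
  have e1 : ∀ F : (Fin T → A) → (Fin T → B) → A → B → ℝ,
      ∑ a, ∑ b, ∑ α, ∑ β, F a b α β = ∑ α, ∑ β, ∑ a, ∑ b, F a b α β := by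
    intro F
    simp only [Finset.sum_comm (s := (Finset.univ : Finset (Fin T → B)))
      (t := (Finset.univ : Finset A)), Finset.sum_comm (s := (Finset.univ : Finset (Fin T → A)))
      (t := (Finset.univ : Finset A)), Finset.sum_comm (s := (Finset.univ : Finset (Fin T → B)))
      (t := (Finset.univ : Finset B)), Finset.sum_comm (s := (Finset.univ : Finset (Fin T → A)))
      (t := (Finset.univ : Finset B))]
  exact e1 _

theorem condExpect_const (s : TypeStrategy T A B A) (t : TypeStrategy T A B B) (c : ℝ)
    {n : ℕ} (hn : n ≤ T) (hA : Fin n → A) (hB : Fin n → B) :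
    condExpect s t (fun _ _ => c) n hn hA hB = c := by
  induction hn using Nat.decreasingInduction with
  | self => exact condExpect_length ..
  | of_succ n hn ih =>
    rw [condExpect_step s t _ hn]
    simp only [ih, mul_assoc, ← Finset.mul_sum, ← Finset.sum_mul]
    rw [(t ⟨n, hn⟩ hA hB).2.2, (s ⟨n, hn⟩ hA hB).2.2, one_mul, one_mul]

/-- The expected sum of the stage payoffs `m` from stage `n` on, given the history `(hA, hB)`. It
agrees with `futurePayoff` for `n < T` and vanishes for `n = T`. -/
noncomputable def tailPayoff (m : A → B → ℝ) (s : TypeStrategy T A B A)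
    (t : TypeStrategy T A B B) (n : ℕ) (hn : n ≤ T) (hA : Fin n → A) (hB : Fin n → B) : ℝ :=
  condExpect s t
    (fun a b => ∑ r ∈ Finset.univ.filter (fun r : Fin T => n ≤ r), m (a r) (b r)) n hn hA hB

theorem tailPayoff_length (m : A → B → ℝ) (s : TypeStrategy T A B A)
    (t : TypeStrategy T A B B) (hA : Fin T → A) (hB : Fin T → B) :
    tailPayoff m s t T le_rfl hA hB = 0 := by
  unfold tailPayoff
  rw [condExpect_length, Finset.filter_false_of_mem (fun r _ => not_le.2 r.2), Finset.sum_empty]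

theorem tailPayoff_step (m : A → B → ℝ) (s : TypeStrategy T A B A)
    (t : TypeStrategy T A B B) {n : ℕ} (hn : n < T) (hA : Fin n → A) (hB : Fin n → B) :
    tailPayoff m s t n hn.le hA hB =
      ∑ α, ∑ β, (s ⟨n, hn⟩ hA hB).1 α * (t ⟨n, hn⟩ hA hB).1 β *
        (m α β + tailPayoff m s t (n + 1) hn (Fin.snoc hA α) (Fin.snoc hB β)) := by
  unfold tailPayoff
  rw [condExpect_step s t _ hn]
  refine Finset.sum_congr rfl fun α _ => Finset.sum_congr rfl fun β _ => ?_
  congr 1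
  conv_rhs => rw [← condExpect_const s t (m α β) hn (Fin.snoc hA α) (Fin.snoc hB β)]
  simp only [condExpect, ← Finset.sum_add_distrib]
  refine Finset.sum_congr rfl fun a _ => Finset.sum_congr rfl fun b _ => ?_
  split_ifs with h
  · obtain ⟨-, rfl⟩ := (pre_succ_eq_snoc_iff a hn hA α).1 h.1
    obtain ⟨-, rfl⟩ := (pre_succ_eq_snoc_iff b hn hB β).1 h.2
    rw [filter_stage_le_eq_insert hn, Finset.sum_insert (by simp), mul_add]
  · simp

end Histories

/-! ### Realization probabilities -/

section Reach

variable {T : ℕ} {L A B : Type*} [Fintype B]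

/-- `reach₂`, with the length `n = T` allowed. -/
def reachUpTo₂ (q : L → ℝ) (τ : Strategy T L A B B) (n : ℕ) (hn : n ≤ T) (l : L)
    (hA : Fin n → A) (hB : Fin n → B) : ℝ :=
  q l * ∏ s : Fin n,
    (τ l ⟨s, s.2.trans_le hn⟩ (pre hA s s.2.le) (pre hB s s.2.le)).1 (hB s)

theorem reachUpTo₂_zero (q : L → ℝ) (τ : Strategy T L A B B) (hn : 0 ≤ T) (l : L)
    (hA : Fin 0 → A) (hB : Fin 0 → B) : reachUpTo₂ q τ 0 hn l hA hB = q l := by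
  simp [reachUpTo₂]

/-- The realization plan after stage `n` is the weight of the longer history. Player 1's last action
`a` does not matter. -/
theorem reachUpTo₂_succ (q : L → ℝ) (τ : Strategy T L A B B) {n : ℕ} (hn : n < T) (l : L)
    (hA : Fin n → A) (hB : Fin n → B) (a : A) (b : B) :
    reachUpTo₂ q τ (n + 1) hn l (Fin.snoc hA a) (Fin.snoc hB b) =
      plan₂ q τ ⟨n, hn⟩ l hA hB b := by
  unfold reachUpTo₂ plan₂ reach₂
  rw [Fin.prod_univ_castSucc, ← mul_assoc]
  congr 1
  · congr 1
    refine Finset.prod_congr rfl fun s _ => ?_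
    rw [Fin.snoc_castSucc]
    simp only [Fin.val_castSucc]
    rw [pre_snoc hA a s.2.le, pre_snoc hB b s.2.le]
  · rw [Fin.snoc_last]
    simp only [Fin.val_last]
    rw [pre_snoc hA a le_rfl, pre_snoc hB b le_rfl]
    rfl

theorem reachUpTo₂_nonneg {q : L → ℝ} (hq : ∀ l, 0 ≤ q l) (τ : Strategy T L A B B) {n : ℕ}
    (hn : n ≤ T) (l : L) (hA : Fin n → A) (hB : Fin n → B) : 0 ≤ reachUpTo₂ q τ n hn l hA hB :=
  mul_nonneg (hq l) (Finset.prod_nonneg fun _ _ => (τ l _ _ _).2.1 _)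

theorem plan₂_eq (q : L → ℝ) (τ : Strategy T L A B B) {n : ℕ} (hn : n < T) (l : L)
    (hA : Fin n → A) (hB : Fin n → B) (b : B) :
    plan₂ q τ ⟨n, hn⟩ l hA hB b =
      reachUpTo₂ q τ n hn.le l hA hB * (τ l ⟨n, hn⟩ hA hB).1 b :=
  rfl

end Reach

/-! ### Future security payoffs and Bellman's equation -/

section Bellman

variable {T : ℕ} {K L A B : Type*} [Fintype L] [Fintype A] [Fintype B]

/-- The payoff from stage `n` on that player 1's type `k` collects against `τ` after `(hA, hB)` by
using `s`, weighted by the probabilities `reachUpTo₂` of the types of player 2. -/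
noncomputable def weightedPayoff (M : K → L → A → B → ℝ) (q : L → ℝ) (τ : Strategy T L A B B)
    (k : K) (s : TypeStrategy T A B A) (n : ℕ) (hn : n ≤ T) (hA : Fin n → A) (hB : Fin n → B) : ℝ :=
  ∑ l, reachUpTo₂ q τ n hn l hA hB * tailPayoff (M k l) s (τ l) n hn hA hB

theorem futureSecurity₂_eq (M : K → L → A → B → ℝ) (q : L → ℝ) (τ : Strategy T L A B B)
    (n : Fin T) (k : K) (hA : Fin n → A) (hB : Fin n → B) :
    futureSecurity₂ M q τ n k hA hB = ⨆ s, weightedPayoff M q τ k s n n.2.le hA hB :=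
  rfl

theorem weightedPayoff_length (M : K → L → A → B → ℝ) (q : L → ℝ) (τ : Strategy T L A B B)
    (k : K) (s : TypeStrategy T A B A) (hA : Fin T → A) (hB : Fin T → B) :
    weightedPayoff M q τ k s T le_rfl hA hB = 0 := by
  simp [weightedPayoff, tailPayoff_length]

/-- Player 1's one-step recursion against `τ`. It involves `τ` only through its realization plan. -/
theorem weightedPayoff_step (M : K → L → A → B → ℝ) (q : L → ℝ) (τ : Strategy T L A B B)
    (k : K) (s : TypeStrategy T A B A) {n : ℕ} (hn : n < T) (hA : Fin n → A) (hB : Fin n → B) :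
    weightedPayoff M q τ k s n hn.le hA hB =
      ∑ a, (s ⟨n, hn⟩ hA hB).1 a *
        (∑ l, ∑ b, M k l a b * plan₂ q τ ⟨n, hn⟩ l hA hB b +
          ∑ b, weightedPayoff M q τ k s (n + 1) hn (Fin.snoc hA a) (Fin.snoc hB b)) := by
  simp only [weightedPayoff, tailPayoff_step _ _ _ hn, reachUpTo₂_succ, plan₂_eq]
  simp only [Finset.mul_sum]
  rw [Finset.sum_comm]
  refine Finset.sum_congr rfl fun a _ => ?_
  rw [Finset.sum_comm (s := (Finset.univ : Finset B)), ← Finset.sum_add_distrib, Finset.mul_sum]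
  refine Finset.sum_congr rfl fun l _ => ?_
  rw [← Finset.sum_add_distrib, Finset.mul_sum]
  refine Finset.sum_congr rfl fun b _ => ?_
  ring

/-- Backward induction: a function satisfying the Bellman inequalities bounds the payoff of every
strategy. -/
theorem weightedPayoff_le {M : K → L → A → B → ℝ} {q : L → ℝ} {τ : Strategy T L A B B} {k : K}
    {w : (n : ℕ) → (Fin n → A) → (Fin n → B) → ℝ} (hT : ∀ hA hB, 0 ≤ w T hA hB)
    (hw : ∀ (n : ℕ) (hn : n < T) hA hB a,
      ∑ l, ∑ b, M k l a b * plan₂ q τ ⟨n, hn⟩ l hA hB b +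
        ∑ b, w (n + 1) (Fin.snoc hA a) (Fin.snoc hB b) ≤ w n hA hB)
    (s : TypeStrategy T A B A) {n : ℕ} (hn : n ≤ T) (hA : Fin n → A) (hB : Fin n → B) :
    weightedPayoff M q τ k s n hn hA hB ≤ w n hA hB := by
  induction hn using Nat.decreasingInduction with
  | self => rw [weightedPayoff_length]; exact hT _ _
  | of_succ n hn ih =>
    rw [weightedPayoff_step M q τ k s hn]
    calc _ ≤ ∑ a, (s ⟨n, hn⟩ hA hB).1 a * w n hA hB := by
          refine Finset.sum_le_sum fun a _ =>
            mul_le_mul_of_nonneg_left (le_trans ?_ (hw n hn hA hB a)) ((s _ _ _).2.1 a)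
          gcongr
          exact ih _ _
      _ = w n hA hB := by rw [← Finset.sum_mul, (s _ _ _).2.2, one_mul]

variable [Nonempty A]

/-- The solution `w` of player 1's Bellman equation
`w(h) = max_a (∑_{l,b} M y^b(h) + ∑_b w(h,a,b))` against the realization plan `y`, with `w = 0` at
complete histories. -/
noncomputable def bellman (M : K → L → A → B → ℝ) (y : PlanSpace T L A B B) (k : K) :
    (n : ℕ) → (Fin n → A) → (Fin n → B) → ℝ
  | n, hA, hB =>
    if h : n < T then
      Finset.univ.sup' Finset.univ_nonempty fun a =>
        ∑ l, ∑ b, M k l a b * y ⟨n, h⟩ l hA hB b +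
          ∑ b, bellman M y k (n + 1) (Fin.snoc hA a) (Fin.snoc hB b)
    else 0
  termination_by n => T - n

theorem exists_bellman_eq (M : K → L → A → B → ℝ) (y : PlanSpace T L A B B) (k : K) {n : ℕ}
    (hn : n < T) (hA : Fin n → A) (hB : Fin n → B) :
    ∃ a, bellman M y k n hA hB = ∑ l, ∑ b, M k l a b * y ⟨n, hn⟩ l hA hB b +
          ∑ b, bellman M y k (n + 1) (Fin.snoc hA a) (Fin.snoc hB b) := by
  obtain ⟨a, -, ha⟩ := Finset.exists_mem_eq_sup' (Finset.univ_nonempty (α := A)) fun a =>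
        ∑ l, ∑ b, M k l a b * y ⟨n, hn⟩ l hA hB b +
          ∑ b, bellman M y k (n + 1) (Fin.snoc hA a) (Fin.snoc hB b)
  refine ⟨a, ?_⟩
  rw [bellman, dif_pos hn, ha]

theorem le_bellman (M : K → L → A → B → ℝ) (y : PlanSpace T L A B B) (k : K) {n : ℕ}
    (hn : n < T) (hA : Fin n → A) (hB : Fin n → B) (a : A) :
    ∑ l, ∑ b, M k l a b * y ⟨n, hn⟩ l hA hB b +
      ∑ b, bellman M y k (n + 1) (Fin.snoc hA a) (Fin.snoc hB b) ≤ bellman M y k n hA hB := by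
  conv_rhs => rw [bellman, dif_pos hn]
  exact Finset.le_sup' (fun a => ∑ l, ∑ b, M k l a b * y ⟨n, hn⟩ l hA hB b +
      ∑ b, bellman M y k (n + 1) (Fin.snoc hA a) (Fin.snoc hB b)) (Finset.mem_univ a)

theorem bellman_length (M : K → L → A → B → ℝ) (y : PlanSpace T L A B B) (k : K)
    (hA : Fin T → A) (hB : Fin T → B) : bellman M y k T hA hB = 0 := by
  rw [bellman, dif_neg (lt_irrefl T)]

open Classical in
/-- The strategy of type `k` that plays a maximizer of the Bellman equation at every history. -/
noncomputable def bellmanStrategy (M : K → L → A → B → ℝ) (y : PlanSpace T L A B B) (k : K) :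
    TypeStrategy T A B A := fun n hA hB =>
  ⟨Pi.single (exists_bellman_eq M y k n.2 hA hB).choose 1, single_mem_stdSimplex ℝ _⟩

/-- The strategy `bellmanStrategy` is optimal at all histories at once, so that the suprema defining
`futureSecurity₂` are attained. -/
theorem weightedPayoff_bellmanStrategy (M : K → L → A → B → ℝ) (q : L → ℝ)
    (τ : Strategy T L A B B) (k : K) {n : ℕ} (hn : n ≤ T) (hA : Fin n → A) (hB : Fin n → B) :
    weightedPayoff M q τ k (bellmanStrategy M (plan₂ q τ) k) n hn hA hB =
      bellman M (plan₂ q τ) k n hA hB := by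
  classical
  induction hn using Nat.decreasingInduction with
  | self => rw [weightedPayoff_length, bellman_length]
  | of_succ n hn ih =>
    rw [weightedPayoff_step M q τ k _ hn,
      (exists_bellman_eq M (plan₂ q τ) k hn hA hB).choose_spec]
    simp only [ih]
    rw [Finset.sum_eq_single (exists_bellman_eq M (plan₂ q τ) k hn hA hB).choose]
    · simp [bellmanStrategy]
    · intro a _ ha
      simp [bellmanStrategy, Pi.single_eq_of_ne ha]
    · simp

theorem weightedPayoff_le_bellman (M : K → L → A → B → ℝ) (q : L → ℝ)
    (τ : Strategy T L A B B) (k : K) (s : TypeStrategy T A B A) {n : ℕ} (hn : n ≤ T)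
    (hA : Fin n → A) (hB : Fin n → B) :
    weightedPayoff M q τ k s n hn hA hB ≤ bellman M (plan₂ q τ) k n hA hB :=
  weightedPayoff_le (fun _ _ => (bellman_length ..).ge)
    (fun _ hn hA hB a => le_bellman M _ k hn hA hB a) s hn hA hB

theorem futureSecurity₂_eq_bellman (M : K → L → A → B → ℝ) (q : L → ℝ)
    (τ : Strategy T L A B B) (n : Fin T) (k : K) (hA : Fin n → A) (hB : Fin n → B) :
    futureSecurity₂ M q τ n k hA hB = bellman M (plan₂ q τ) k n hA hB := by
  rw [futureSecurity₂_eq]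
  refine IsGreatest.csSup_eq ⟨⟨_, weightedPayoff_bellmanStrategy M q τ k n.2.le hA hB⟩, ?_⟩
  rintro _ ⟨s, rfl⟩
  exact weightedPayoff_le_bellman M q τ k s n.2.le hA hB

theorem next_futureSecurity₂ (M : K → L → A → B → ℝ) (q : L → ℝ)
    (τ : Strategy T L A B B) (n : Fin T) (k : K) (hA : Fin (n + 1) → A) (hB : Fin (n + 1) → B) :
    next (futureSecurity₂ M q τ) n k hA hB = bellman M (plan₂ q τ) k (n + 1) hA hB := by
  unfold next
  split_ifs with h
  · exact futureSecurity₂_eq_bellman M q τ ⟨n + 1, h⟩ k hA hB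
  · rw [bellman, dif_neg h]

/-- A feasible `w` of player 2's linear program lies above the weighted future security payoffs. -/
theorem futureSecurity₂_le {M : K → L → A → B → ℝ} {q : L → ℝ} {τ : Strategy T L A B B}
    {w : SecuritySpace T K A B} (h : Feasible₂ M q (plan₂ q τ) w) (n : Fin T) (k : K)
    (hA : Fin n → A) (hB : Fin n → B) : futureSecurity₂ M q τ n k hA hB ≤ w n k hA hB := by
  rw [futureSecurity₂_eq_bellman, ← weightedPayoff_bellmanStrategy M q τ k n.2.le]
  have := weightedPayoff_le (M := M) (q := q) (τ := τ) (k := k)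
    (w := fun n hA hB => if h : n < T then w ⟨n, h⟩ k hA hB else 0)
    (fun _ _ => by simp)
    (fun n hn hA hB a => by
      simp only [dif_pos hn]
      exact h.2 ⟨n, hn⟩ k hA hB a)
    (bellmanStrategy M (plan₂ q τ) k) n.2.le hA hB
  simpa using this

end Bellman

/-! ### Payoffs against a fixed strategy of player 2 -/

section Payoff

variable {T : ℕ} {K L A B : Type*} [Fintype K] [Fintype L] [Fintype A] [Fintype B]

theorem expectation_eq (p : K → ℝ) (q : L → ℝ) (σ : Strategy T K A B A)
    (τ : Strategy T L A B B) (f : K → L → (Fin T → A) → (Fin T → B) → ℝ) :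
    expectation p q σ τ f =
      ∑ k, ∑ l, p k * q l *
        condExpect (σ k) (τ l) (f k l) 0 T.zero_le Fin.elim0 Fin.elim0 := by
  unfold expectation playProb condExpect
  refine Finset.sum_congr rfl fun k _ => Finset.sum_congr rfl fun l _ => ?_
  simp only [Finset.mul_sum]
  refine Finset.sum_congr rfl fun a _ => Finset.sum_congr rfl fun b _ => ?_
  rw [if_pos ⟨Subsingleton.elim _ _, Subsingleton.elim _ _⟩, mul_assoc]

theorem payoff_eq_sum_tailPayoff (M : K → L → A → B → ℝ) (p : K → ℝ) (q : L → ℝ)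
    (σ : Strategy T K A B A) (τ : Strategy T L A B B) :
    payoff M p q σ τ = ∑ k, ∑ l, p k * q l *
      tailPayoff (M k l) (σ k) (τ l) 0 T.zero_le Fin.elim0 Fin.elim0 := by
  simp [payoff, expectation_eq, tailPayoff]

theorem payoff_eq_sum_weightedPayoff (M : K → L → A → B → ℝ) (p : K → ℝ) (q : L → ℝ)
    (σ : Strategy T K A B A) (τ : Strategy T L A B B) :
    payoff M p q σ τ =
      ∑ k, p k * weightedPayoff M q τ k (σ k) 0 T.zero_le Fin.elim0 Fin.elim0 := by
  simp [payoff_eq_sum_tailPayoff, weightedPayoff, reachUpTo₂_zero, Finset.mul_sum, mul_assoc]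

theorem dualPayoff₁_eq (M : K → L → A → B → ℝ) (μ : K → ℝ) {q : L → ℝ} (hq : q ∈ stdSimplex ℝ L)
    (s : stdSimplex ℝ K × Strategy T K A B A) (τ : Strategy T L A B B) :
    dualPayoff₁ M μ q s τ = ∑ k, s.1.1 k * μ k + payoff M s.1.1 q s.2 τ := by
  have h : ∑ k, s.1.1 k * μ k = expectation s.1.1 q s.2 τ fun k _ _ _ => μ k := by
    rw [expectation_eq]
    refine Finset.sum_congr rfl fun k _ => ?_
    simp only [condExpect_const]
    rw [← Finset.sum_mul, ← Finset.mul_sum, hq.2, mul_one]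
  rw [h]
  simp only [dualPayoff₁, payoff, expectation, mul_add, Finset.sum_add_distrib]

/-- Spreading the initial regret evenly over the stages turns the dual payoff into a payoff. -/
theorem dualPayoff₁_eq_payoff (hT : 0 < T) (M : K → L → A → B → ℝ) (μ : K → ℝ) (q : L → ℝ)
    (s : stdSimplex ℝ K × Strategy T K A B A) (τ : Strategy T L A B B) :
    dualPayoff₁ M μ q s τ =
      payoff (fun k l a b => M k l a b + μ k / T) s.1.1 q s.2 τ := by
  have hT' : (T : ℝ) ≠ 0 := by positivity
  simp only [dualPayoff₁, payoff]
  congr 1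
  funext k l a b
  rw [Finset.sum_add_distrib, Finset.sum_const, Finset.card_univ, Fintype.card_fin, nsmul_eq_mul,
    mul_div_cancel₀ _ hT', add_comm]

variable [Nonempty A]

theorem payoff_le (hT : 0 < T) (M : K → L → A → B → ℝ) {p : K → ℝ} (hp : ∀ k, 0 ≤ p k) (q : L → ℝ)
    (σ : Strategy T K A B A) (τ : Strategy T L A B B) :
    payoff M p q σ τ ≤ ∑ k, p k * initial hT (futureSecurity₂ M q τ) k := by
  rw [payoff_eq_sum_weightedPayoff]
  refine Finset.sum_le_sum fun k _ => mul_le_mul_of_nonneg_left ?_ (hp k)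
  rw [initial, futureSecurity₂_eq_bellman]
  exact weightedPayoff_le_bellman ..

theorem payoff_bellmanStrategy (hT : 0 < T) (M : K → L → A → B → ℝ) (p : K → ℝ) (q : L → ℝ)
    (τ : Strategy T L A B B) :
    payoff M p q (fun k => bellmanStrategy M (plan₂ q τ) k) τ =
      ∑ k, p k * initial hT (futureSecurity₂ M q τ) k := by
  rw [payoff_eq_sum_weightedPayoff]
  refine Finset.sum_congr rfl fun k _ => ?_
  rw [initial, futureSecurity₂_eq_bellman, weightedPayoff_bellmanStrategy]

/-- The best payoff of player 1 against `τ`: his types maximize separately. -/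
theorem isGreatest_payoff (hT : 0 < T) (M : K → L → A → B → ℝ) {p : K → ℝ} (hp : ∀ k, 0 ≤ p k)
    (q : L → ℝ) (τ : Strategy T L A B B) :
    IsGreatest (Set.range fun σ => payoff M p q σ τ)
      (∑ k, p k * initial hT (futureSecurity₂ M q τ) k) := by
  refine ⟨⟨_, payoff_bellmanStrategy hT M p q τ⟩, ?_⟩
  rintro _ ⟨σ, rfl⟩
  exact payoff_le hT M hp q σ τ

end Payoff

/-! ### A minimax theorem -/

section Minimax

/-- A game whose payoff is bilinear in parameters of the strategies that range over compact convex
sets has a value, by Sion's theorem. -/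
theorem isValue_gameValue_of_bilinear {S S' E F : Type*} [Nonempty S] [Nonempty S']
    [TopologicalSpace E] [AddCommGroup E] [Module ℝ E] [IsTopologicalAddGroup E]
    [ContinuousSMul ℝ E] [TopologicalSpace F] [AddCommGroup F] [Module ℝ F]
    [IsTopologicalAddGroup F] [ContinuousSMul ℝ F] {g : S → S' → ℝ} {φ : S → E} {ψ : S' → F}
    (G : E → F → ℝ) (hg : ∀ s t, g s t = G (φ s) (ψ t))
    (hφ : Convex ℝ (Set.range φ)) (hφ' : IsCompact (Set.range φ))
    (hψ : Convex ℝ (Set.range ψ)) (hψ' : IsCompact (Set.range ψ))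
    (hG₁ : ∀ y, IsLinearMap ℝ fun x => G x y) (hG₁' : ∀ y, Continuous fun x => G x y)
    (hG₂ : ∀ x, IsLinearMap ℝ fun y => G x y) (hG₂' : ∀ x, Continuous fun y => G x y) :
    IsValue g (gameValue g) := by
  obtain ⟨_, ⟨t₀, rfl⟩, _, ⟨s₀, rfl⟩, h⟩ := Sion.exists_isSaddlePointOn
    (f := fun y x => G x y) (Set.range_nonempty ψ) hψ hψ'
    (fun x _ => (hG₂' x).lowerSemicontinuous.lowerSemicontinuousOn _)
    (fun x _ => (((hG₂ x).mk' _).convexOn hψ).quasiconvexOn) hφ (Set.range_nonempty φ) hφ'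
    (fun y _ => (hG₁' y).upperSemicontinuous.upperSemicontinuousOn _)
    (fun y _ => (((hG₁ y).mk' _).concaveOn hφ).quasiconcaveOn)
  have hs : ∀ s t, g s t₀ ≤ g s₀ t := by
    intro s t
    rw [hg, hg]
    exact h _ ⟨t, rfl⟩ _ ⟨s, rfl⟩
  -- `gameValue` involves infima of reals, which are `0` by convention without a lower bound.
  have hbdd : ∀ s, BddBelow (Set.range fun t => g s t) := by
    intro s
    obtain ⟨m, hm⟩ := hψ'.bddBelow_image (hG₂' (φ s)).continuousOn
    refine ⟨m, ?_⟩
    rintro _ ⟨t, rfl⟩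
    simp only [hg]
    exact hm ⟨_, ⟨t, rfl⟩, rfl⟩
  have hleast : IsLeast (Set.range fun t => g s₀ t) (g s₀ t₀) :=
    ⟨⟨t₀, rfl⟩, by rintro _ ⟨t, rfl⟩; exact hs s₀ t⟩
  have hgreatest : IsGreatest (Set.range fun s => g s t₀) (g s₀ t₀) :=
    ⟨⟨s₀, rfl⟩, by rintro _ ⟨s, rfl⟩; exact hs s t₀⟩
  have hval : gameValue g = g s₀ t₀ := by
    refine IsGreatest.csSup_eq ⟨⟨s₀, hleast.csInf_eq⟩, ?_⟩
    rintro _ ⟨s, rfl⟩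
    exact (ciInf_le (hbdd s) t₀).trans (hs s t₀)
  rw [hval]
  refine ⟨⟨⟨s₀, hleast⟩, ?_⟩, ⟨⟨t₀, hgreatest⟩, ?_⟩⟩
  · rintro m ⟨s, hm⟩
    exact (hm.2 ⟨t₀, rfl⟩).trans (hs s t₀)
  · rintro m ⟨t, hm⟩
    exact (hs s₀ t).trans (hm.2 ⟨s₀, rfl⟩)

end Minimax

/-! ### The set of realization plans -/

section Plans

variable {T : ℕ} {L A B : Type*} [Fintype B]

theorem plan₂_mem_planSet₂ {q : L → ℝ} (hq : ∀ l, 0 ≤ q l) (τ : Strategy T L A B B) :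
    plan₂ q τ ∈ planSet₂ q := by
  refine ⟨fun n l hA hB b => mul_nonneg (reachUpTo₂_nonneg hq τ n.2.le l hA hB)
    ((τ l n hA hB).2.1 b), fun h l => ?_, fun n h l hA hB a b => ?_⟩
  · simp only [plan₂_eq q τ h]
    rw [← Finset.mul_sum, (τ _ _ _ _).2.2, mul_one, reachUpTo₂_zero]
  · simp only [plan₂_eq q τ h]
    rw [← Finset.mul_sum, (τ _ _ _ _).2.2, mul_one, reachUpTo₂_succ]

open Classical in
/-- The behavior strategy that plays proportionally to `y`, and arbitrarily at histories that `y`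
does not reach. -/
noncomputable def strategyOfPlan [Nonempty B] (y : PlanSpace T L A B B)
    (hy : ∀ n l hA hB b, 0 ≤ y n l hA hB b) : Strategy T L A B B := fun l n hA hB =>
  if h : ∑ b, y n l hA hB b = 0 then
    ⟨Pi.single (Classical.arbitrary B) 1, single_mem_stdSimplex ℝ _⟩
  else ⟨fun b => y n l hA hB b / ∑ b', y n l hA hB b',
    fun b => div_nonneg (hy ..) (Finset.sum_nonneg fun _ _ => hy ..), by
      rw [← Finset.sum_div, div_self h]⟩

theorem sum_mul_strategyOfPlan [Nonempty B] {y : PlanSpace T L A B B}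
    (hy : ∀ n l hA hB b, 0 ≤ y n l hA hB b) (n : Fin T) (l : L) (hA : Fin n → A) (hB : Fin n → B)
    (b : B) : (∑ b', y n l hA hB b') * (strategyOfPlan y hy l n hA hB).1 b = y n l hA hB b := by
  unfold strategyOfPlan
  split_ifs with h
  · rw [h, zero_mul]
    exact ((Finset.sum_eq_zero_iff_of_nonneg fun b _ => hy n l hA hB b).1 h b
      (Finset.mem_univ b)).symm
  · exact mul_div_cancel₀ _ h

/-- Every point of the polyhedron `planSet₂ q` is a realization plan. -/
theorem plan₂_strategyOfPlan [Nonempty B] {q : L → ℝ} {y : PlanSpace T L A B B}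
    (hy : y ∈ planSet₂ q) : plan₂ q (strategyOfPlan y hy.1) = y := by
  have key : ∀ (n : ℕ) (hn : n < T) (l : L) (hA : Fin n → A) (hB : Fin n → B) (b : B),
      plan₂ q (strategyOfPlan y hy.1) ⟨n, hn⟩ l hA hB b = y ⟨n, hn⟩ l hA hB b := by
    intro n
    induction n with
    | zero =>
      intro hn l hA hB b
      obtain rfl : hA = Fin.elim0 := Subsingleton.elim _ _
      obtain rfl : hB = Fin.elim0 := Subsingleton.elim _ _
      rw [plan₂_eq, reachUpTo₂_zero, ← hy.2.1 hn l]
      exact sum_mul_strategyOfPlan hy.1 ..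
    | succ n ih =>
      intro hn l hA hB b
      rw [plan₂_eq, ← Fin.snoc_init_self hA, ← Fin.snoc_init_self hB, reachUpTo₂_succ, ih,
        ← hy.2.2 n hn l]
      exact sum_mul_strategyOfPlan hy.1 ..
  funext n l hA hB b
  exact key n n.2 l hA hB b

theorem range_plan₂ [Nonempty B] {q : L → ℝ} (hq : ∀ l, 0 ≤ q l) :
    Set.range (plan₂ (T := T) (A := A) (B := B) q) = planSet₂ q := by
  ext y
  exact ⟨by rintro ⟨τ, rfl⟩; exact plan₂_mem_planSet₂ hq τ, fun hy => ⟨_, plan₂_strategyOfPlan hy⟩⟩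

theorem smul_add_smul_mem_planSet₂ {q q' : L → ℝ} {y y' : PlanSpace T L A B B}
    (hy : y ∈ planSet₂ q) (hy' : y' ∈ planSet₂ q') {a b : ℝ} (ha : 0 ≤ a) (hb : 0 ≤ b) :
    a • y + b • y' ∈ planSet₂ (a • q + b • q') := by
  refine ⟨fun n l hA hB c => add_nonneg (mul_nonneg ha (hy.1 ..)) (mul_nonneg hb (hy'.1 ..)),
    fun h l => ?_, fun n h l hA hB α β => ?_⟩
  · simp only [Pi.add_apply, Pi.smul_apply, smul_eq_mul, Finset.sum_add_distrib, ← Finset.mul_sum]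
    rw [hy.2.1, hy'.2.1]
  · simp only [Pi.add_apply, Pi.smul_apply, smul_eq_mul, Finset.sum_add_distrib, ← Finset.mul_sum]
    rw [hy.2.2, hy'.2.2]

theorem convex_range_plan₂ [Nonempty B] {q : L → ℝ} (hq : ∀ l, 0 ≤ q l) :
    Convex ℝ (Set.range (plan₂ (T := T) (A := A) (B := B) q)) := by
  rw [range_plan₂ hq]
  intro y hy y' hy' a b ha hb hab
  have := smul_add_smul_mem_planSet₂ hy hy' ha hb
  rwa [← add_smul, hab, one_smul] at this

theorem continuous_plan₂ : Continuous fun s : (L → ℝ) × Strategy T L A B B => plan₂ s.1 s.2 := by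
  have h : ∀ (l : L) (n : Fin T) (hA : Fin n → A) (hB : Fin n → B) b,
      Continuous fun s : (L → ℝ) × Strategy T L A B B => (s.2 l n hA hB).1 b := by
    intro l n hA hB b
    have h1 : Continuous fun s : (L → ℝ) × Strategy T L A B B => s.2 l n hA hB := by fun_prop
    exact (continuous_apply b).comp (continuous_subtype_val.comp h1)
  refine continuous_pi fun n => continuous_pi fun l => continuous_pi fun hA =>
    continuous_pi fun hB => continuous_pi fun b => ?_
  unfold plan₂ reach₂
  refine Continuous.mul (Continuous.mul (by fun_prop) ?_) (h ..)
  exact continuous_finsetProd _ fun _ _ => h ..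

theorem isCompact_range_plan₂ (q : L → ℝ) :
    IsCompact (Set.range (plan₂ (T := T) (A := A) (B := B) q)) :=
  isCompact_range (continuous_plan₂.comp (Continuous.prodMk_right q))

theorem isCompact_range_plan₂_prior [Fintype L] :
    IsCompact (Set.range fun s : stdSimplex ℝ L × Strategy T L A B B => plan₂ s.1.1 s.2) :=
  isCompact_range (continuous_plan₂.comp (by fun_prop :
    Continuous fun s : stdSimplex ℝ L × Strategy T L A B B => (s.1.1, s.2)))

theorem convex_range_plan₂_prior [Fintype L] [Nonempty B] :
    Convex ℝ (Set.range fun s : stdSimplex ℝ L × Strategy T L A B B => plan₂ s.1.1 s.2) := by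
  rintro _ ⟨⟨q, τ⟩, rfl⟩ _ ⟨⟨q', τ'⟩, rfl⟩ a b ha hb hab
  exact ⟨⟨⟨a • q.1 + b • q'.1, convex_stdSimplex ℝ L q.2 q'.2 ha hb hab⟩, _⟩,
    plan₂_strategyOfPlan (smul_add_smul_mem_planSet₂ (plan₂_mem_planSet₂ q.2.1 τ)
      (plan₂_mem_planSet₂ q'.2.1 τ') ha hb)⟩

end Plans

/-! ### Plans of player 1 -/

section Exchange

variable {T : ℕ} {Θ A B C : Type*}

/-- The same strategy of a type, with the two players' histories in the other order. -/
def TypeStrategy.flip [Fintype C] (s : TypeStrategy T A B C) : TypeStrategy T B A C :=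
  fun n hB hA => s n hA hB

/-- The same strategy with the two players' histories in the other order, so that a strategy of one
player becomes a strategy of the other in the game with the roles exchanged. -/
def Strategy.flip [Fintype C] (σ : Strategy T Θ A B C) : Strategy T Θ B A C :=
  fun θ => TypeStrategy.flip (σ θ)

/-- The exchange of the two histories in the index of a realization plan. -/
def flipPlan : PlanSpace T Θ A B C →ₗ[ℝ] PlanSpace T Θ B A C where
  toFun x := fun n θ hB hA c => x n θ hA hB c
  map_add' _ _ := rfl
  map_smul' _ _ := rfl

theorem continuous_flipPlan : Continuous (flipPlan : PlanSpace T Θ A B C → PlanSpace T Θ B A C) := by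
  refine continuous_pi fun n => continuous_pi fun l => continuous_pi fun hA =>
    continuous_pi fun hB => continuous_pi fun b => ?_
  simp only [flipPlan, LinearMap.coe_mk, AddHom.coe_mk]
  fun_prop

variable [Fintype A]

theorem plan₁_eq_flipPlan (p : Θ → ℝ) (σ : Strategy T Θ A B A) :
    plan₁ p σ = flipPlan (plan₂ p σ.flip) :=
  rfl

theorem range_plan₁ (p : Θ → ℝ) :
    Set.range (plan₁ (T := T) (A := A) (B := B) p) =
      flipPlan '' Set.range (plan₂ (T := T) (A := B) (B := A) p) := by
  ext x
  constructor
  · rintro ⟨σ, rfl⟩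
    exact ⟨_, ⟨σ.flip, rfl⟩, rfl⟩
  · rintro ⟨_, ⟨τ, rfl⟩, rfl⟩
    exact ⟨τ.flip, rfl⟩

theorem range_plan₁_prior [Fintype Θ] :
    (Set.range fun s : stdSimplex ℝ Θ × Strategy T Θ A B A => plan₁ s.1.1 s.2) =
      flipPlan '' Set.range fun s : stdSimplex ℝ Θ × Strategy T Θ B A A => plan₂ s.1.1 s.2 := by
  ext x
  constructor
  · rintro ⟨⟨p, σ⟩, rfl⟩
    exact ⟨_, ⟨(p, σ.flip), rfl⟩, rfl⟩
  · rintro ⟨_, ⟨⟨p, τ⟩, rfl⟩, rfl⟩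
    exact ⟨(p, τ.flip), rfl⟩

end Exchange

/-! ### Bilinearity of the payoff and values of the games -/

section Bilinear

variable {T : ℕ} {K L A B : Type*} [Fintype K] [Fintype L] [Fintype A] [Fintype B]

/-- The expected payoff of stage `n` as a function of the realization plans. -/
def stagePayoff (M : K → L → A → B → ℝ) (x : PlanSpace T K A B A) (y : PlanSpace T L A B B)
    (n : Fin T) : ℝ :=
  ∑ hA, ∑ hB, ∑ a, ∑ b, ∑ k, ∑ l, M k l a b * x n k hA hB a * y n l hA hB b

/-- The tail of the expected payoff splits over the stages, each of which is bilinear in the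
realization plans. -/
theorem sum_tailPayoff_eq (M : K → L → A → B → ℝ) (p : K → ℝ) (q : L → ℝ)
    (σ : Strategy T K A B A) (τ : Strategy T L A B B) {n : ℕ} (hn : n ≤ T) :
    ∑ hA, ∑ hB, ∑ k, ∑ l, reachUpTo₂ p σ.flip n hn k hB hA * reachUpTo₂ q τ n hn l hA hB *
        tailPayoff (M k l) (σ k) (τ l) n hn hA hB =
      ∑ r ∈ Finset.univ.filter (fun r : Fin T => n ≤ r),
        stagePayoff M (plan₁ p σ) (plan₂ q τ) r := by
  induction hn using Nat.decreasingInduction with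
  | self =>
    rw [Finset.filter_false_of_mem (fun r _ => not_le.2 r.2), Finset.sum_empty]
    simp [tailPayoff_length]
  | of_succ n hn ih =>
    rw [filter_stage_le_eq_insert hn, Finset.sum_insert (by simp), ← ih]
    rw [sum_eq_sum_snoc]
    simp only [sum_eq_sum_snoc (C := B), reachUpTo₂_succ, stagePayoff, tailPayoff_step _ _ _ hn]
    rw [← Finset.sum_add_distrib]
    refine Finset.sum_congr rfl fun hA _ => ?_
    rw [Finset.sum_comm (s := (Finset.univ : Finset A)) (t := (Finset.univ : Finset (Fin n → B))),
      ← Finset.sum_add_distrib]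
    refine Finset.sum_congr rfl fun hB _ => ?_
    simp only [← Finset.sum_add_distrib]
    simp only [Finset.mul_sum, Finset.sum_comm (s := (Finset.univ : Finset L))
      (t := (Finset.univ : Finset A)), Finset.sum_comm (s := (Finset.univ : Finset K))
      (t := (Finset.univ : Finset A)), Finset.sum_comm (s := (Finset.univ : Finset L))
      (t := (Finset.univ : Finset B)), Finset.sum_comm (s := (Finset.univ : Finset K))
      (t := (Finset.univ : Finset B))]
    refine Finset.sum_congr rfl fun a _ => Finset.sum_congr rfl fun b _ =>
      Finset.sum_congr rfl fun k _ => Finset.sum_congr rfl fun l _ => ?_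
    -- Both plans factor into the probability of the history and that of the last action.
    rw [plan₂_eq, plan₁_eq_flipPlan]
    change _ = _ * plan₂ p σ.flip ⟨n, hn⟩ k hB hA a * _ +
      plan₂ p σ.flip ⟨n, hn⟩ k hB hA a * _ * _
    rw [plan₂_eq]
    simp only [Strategy.flip, TypeStrategy.flip]
    ring

theorem payoff_eq_sum_stagePayoff (M : K → L → A → B → ℝ) (p : K → ℝ) (q : L → ℝ)
    (σ : Strategy T K A B A) (τ : Strategy T L A B B) :
    payoff M p q σ τ = ∑ n, stagePayoff M (plan₁ p σ) (plan₂ q τ) n := by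
  have h := sum_tailPayoff_eq M p q σ τ T.zero_le
  simp only [Nat.zero_le, Finset.filter_true] at h
  rw [← h, payoff_eq_sum_tailPayoff]
  simp only [Fintype.sum_subsingleton _ (Fin.elim0 : Fin 0 → A),
    Fintype.sum_subsingleton _ (Fin.elim0 : Fin 0 → B), reachUpTo₂_zero]

theorem isLinearMap_stagePayoff_left (M : K → L → A → B → ℝ) (y : PlanSpace T L A B B) :
    IsLinearMap ℝ fun x => ∑ n, stagePayoff M x y n where
  map_add x x' := by
    simp only [stagePayoff, Pi.add_apply, mul_add, add_mul, Finset.sum_add_distrib]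
  map_smul c x := by
    simp only [stagePayoff, Pi.smul_apply, smul_eq_mul, Finset.mul_sum]
    refine Finset.sum_congr rfl fun n _ => ?_
    congr! 6
    ring

theorem isLinearMap_stagePayoff_right (M : K → L → A → B → ℝ) (x : PlanSpace T K A B A) :
    IsLinearMap ℝ fun y => ∑ n, stagePayoff M x y n where
  map_add y y' := by
    simp only [stagePayoff, Pi.add_apply, mul_add, Finset.sum_add_distrib]
  map_smul c y := by
    simp only [stagePayoff, Pi.smul_apply, smul_eq_mul, Finset.mul_sum]
    refine Finset.sum_congr rfl fun n _ => ?_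
    congr! 6
    ring

theorem continuous_stagePayoff_left (M : K → L → A → B → ℝ) (y : PlanSpace T L A B B) :
    Continuous fun x => ∑ n, stagePayoff M x y n := by
  unfold stagePayoff
  fun_prop

theorem continuous_stagePayoff_right (M : K → L → A → B → ℝ) (x : PlanSpace T K A B A) :
    Continuous fun y => ∑ n, stagePayoff M x y n := by
  unfold stagePayoff
  fun_prop

theorem dualPayoff₂_eq_payoff (hT : 0 < T) (M : K → L → A → B → ℝ) (p : K → ℝ) (ν : L → ℝ)
    (σ : Strategy T K A B A) (s : stdSimplex ℝ L × Strategy T L A B B) :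
    dualPayoff₂ M p ν σ s =
      payoff (fun k l a b => M k l a b + ν l / T) p s.1.1 σ s.2 := by
  have hT' : (T : ℝ) ≠ 0 := by positivity
  simp only [dualPayoff₂, payoff]
  congr 1
  funext k l a b
  rw [Finset.sum_add_distrib, Finset.sum_const, Finset.card_univ, Fintype.card_fin, nsmul_eq_mul,
    mul_div_cancel₀ _ hT', add_comm]

variable [Nonempty A] [Nonempty B]

theorem isValue_payoff (M : K → L → A → B → ℝ) {p : K → ℝ} (hp : ∀ k, 0 ≤ p k) {q : L → ℝ}
    (hq : ∀ l, 0 ≤ q l) : IsValue (payoff (T := T) M p q) (gameValue (payoff (T := T) M p q)) := by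
  refine isValue_gameValue_of_bilinear (φ := plan₁ p) (ψ := plan₂ q)
    (fun x y => ∑ n, stagePayoff M x y n)
    (payoff_eq_sum_stagePayoff M p q) ?_ ?_ (convex_range_plan₂ hq) (isCompact_range_plan₂ q)
    (isLinearMap_stagePayoff_left M) (continuous_stagePayoff_left M)
    (isLinearMap_stagePayoff_right M) (continuous_stagePayoff_right M)
  · rw [range_plan₁]
    exact (convex_range_plan₂ hp).linear_image _
  · rw [range_plan₁]
    exact (isCompact_range_plan₂ p).image continuous_flipPlan

theorem isValue_dualPayoff₁ [Nonempty K] (hT : 0 < T) (M : K → L → A → B → ℝ) (μ : K → ℝ)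
    {q : L → ℝ} (hq : ∀ l, 0 ≤ q l) :
    IsValue (dualPayoff₁ (T := T) M μ q) (dualValue₁ T M μ q) := by
  refine isValue_gameValue_of_bilinear
    (φ := fun s : stdSimplex ℝ K × Strategy T K A B A => plan₁ s.1.1 s.2) (ψ := plan₂ q)
    (fun x y => ∑ n, stagePayoff (fun k l a b => M k l a b + μ k / T) x y n)
    (fun s τ => (dualPayoff₁_eq_payoff hT M μ q s τ).trans (payoff_eq_sum_stagePayoff ..))
    ?_ ?_ (convex_range_plan₂ hq) (isCompact_range_plan₂ q)
    (isLinearMap_stagePayoff_left _) (continuous_stagePayoff_left _)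
    (isLinearMap_stagePayoff_right _) (continuous_stagePayoff_right _)
  · rw [range_plan₁_prior]
    exact convex_range_plan₂_prior.linear_image _
  · rw [range_plan₁_prior]
    exact isCompact_range_plan₂_prior.image continuous_flipPlan

theorem isValue_dualPayoff₂ [Nonempty L] (hT : 0 < T) (M : K → L → A → B → ℝ) {p : K → ℝ}
    (hp : ∀ k, 0 ≤ p k) (ν : L → ℝ) :
    IsValue (dualPayoff₂ (T := T) M p ν) (dualValue₂ T M p ν) := by
  refine isValue_gameValue_of_bilinear
    (φ := plan₁ p) (ψ := fun s : stdSimplex ℝ L × Strategy T L A B B => plan₂ s.1.1 s.2)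
    (fun x y => ∑ n, stagePayoff (fun k l a b => M k l a b + ν l / T) x y n)
    (fun σ s => (dualPayoff₂_eq_payoff hT M p ν σ s).trans (payoff_eq_sum_stagePayoff ..))
    ?_ ?_ convex_range_plan₂_prior isCompact_range_plan₂_prior
    (isLinearMap_stagePayoff_left _) (continuous_stagePayoff_left _)
    (isLinearMap_stagePayoff_right _) (continuous_stagePayoff_right _)
  · rw [range_plan₁]
    exact (convex_range_plan₂ hp).linear_image _
  · rw [range_plan₁]
    exact (isCompact_range_plan₂ p).image continuous_flipPlan

end Bilinear

/-! ### The initial regret on player 1's type -/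

section Regret

variable {T : ℕ} {K L A B : Type*} [Fintype L] [Fintype A] [Fintype B] [Nonempty A]

theorem feasible₂_plan₂ (M : K → L → A → B → ℝ) {q : L → ℝ} (hq : ∀ l, 0 ≤ q l)
    (τ : Strategy T L A B B) : Feasible₂ M q (plan₂ q τ) (futureSecurity₂ M q τ) := by
  refine ⟨plan₂_mem_planSet₂ hq τ, fun n k hA hB a => ?_⟩
  simp only [next_futureSecurity₂, futureSecurity₂_eq_bellman]
  exact le_bellman M _ k n.2 hA hB a

variable [Fintype K]

/-- The security strategies of player 2 minimize the objective of his linear program, evaluated at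
the future security payoffs. -/
theorem isSecurity₂_iff (hT : 0 < T) (M : K → L → A → B → ℝ) {p : K → ℝ} (hp : ∀ k, 0 ≤ p k)
    (q : L → ℝ) (τ : Strategy T L A B B) :
    IsSecurity₂ (payoff M p q) τ ↔ ∀ τ' : Strategy T L A B B,
      ∑ k, p k * initial hT (futureSecurity₂ M q τ) k ≤
        ∑ k, p k * initial hT (futureSecurity₂ M q τ') k := by
  constructor
  · rintro ⟨v, hv, hτ⟩ τ'
    rw [(isGreatest_payoff hT M hp q τ).unique hτ]
    exact hv.2 ⟨τ', isGreatest_payoff hT M hp q τ'⟩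
  · intro h
    refine ⟨_, ⟨⟨τ, isGreatest_payoff hT M hp q τ⟩, ?_⟩, isGreatest_payoff hT M hp q τ⟩
    rintro m ⟨τ', hm⟩
    rw [hm.unique (isGreatest_payoff hT M hp q τ')]
    exact h τ'

/-- If no strategy of player 2 does better than `w₀` on average over `p`, then in every dual game
player 1 can choose his type from `p` and guarantee `∑ p^k (μ^k + w₀^k)`. -/
theorem le_dualValue₁ [Nonempty K] [Nonempty B] (hT : 0 < T) (M : K → L → A → B → ℝ) {p : K → ℝ}
    (hp : p ∈ stdSimplex ℝ K) {q : L → ℝ} (hq : q ∈ stdSimplex ℝ L) {w₀ : K → ℝ}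
    (h : ∀ τ : Strategy T L A B B,
      ∑ k, p k * w₀ k ≤ ∑ k, p k * initial hT (futureSecurity₂ M q τ) k) (μ : K → ℝ) :
    ∑ k, p k * μ k + ∑ k, p k * w₀ k ≤ dualValue₁ T M μ q := by
  obtain ⟨τ, hτ⟩ := (isValue_dualPayoff₁ hT M μ hq.1).2.1
  refine le_trans ?_ (hτ.2 ⟨(⟨p, hp⟩, fun k => bellmanStrategy M (plan₂ q τ) k), rfl⟩)
  simp only [dualPayoff₁_eq M μ hq, payoff_bellmanStrategy hT]
  have := h τ
  gcongr

/-- The vector `w₀` stands for the initial future security payoffs of a security strategy as well as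
for the initial components of an optimal solution of the linear program: all that matters is that
some `τ₀` brings every type of player 1 below `w₀`, and that no strategy brings the average over `p`
below that of `w₀`. -/
theorem dualValue₁_eq_zero_and_isInitialRegret₁ [Nonempty K] [Nonempty B] (hT : 0 < T)
    (M : K → L → A → B → ℝ) {p : K → ℝ}
    (hp : p ∈ stdSimplex ℝ K) {q : L → ℝ} (hq : q ∈ stdSimplex ℝ L) {w₀ : K → ℝ}
    (h : ∀ τ : Strategy T L A B B,
      ∑ k, p k * w₀ k ≤ ∑ k, p k * initial hT (futureSecurity₂ M q τ) k)
    {τ₀ : Strategy T L A B B} (h₀ : ∀ k, initial hT (futureSecurity₂ M q τ₀) k ≤ w₀ k) :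
    IsInitialRegret₁ T M p q (fun k => -w₀ k) ∧ dualValue₁ T M (fun k => -w₀ k) q = 0 := by
  have hneg : ∑ k, p k * -w₀ k + ∑ k, p k * w₀ k = 0 := by
    rw [← Finset.sum_add_distrib]
    exact Finset.sum_eq_zero fun k _ => by ring
  have hzero : dualValue₁ T M (fun k => -w₀ k) q = 0 := by
    refine le_antisymm ?_ ?_
    · -- With the regret `-w₀`, the strategy `τ₀` leaves every type of player 1 at most `0`.
      obtain ⟨s, hs⟩ := (isValue_dualPayoff₁ hT M (fun k => -w₀ k) hq.1).1.1
      refine (hs.2 ⟨τ₀, rfl⟩).trans ?_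
      simp only [dualPayoff₁_eq M _ hq]
      have h1 := payoff_le hT M s.1.2.1 q s.2 τ₀
      have h2 : ∑ k, s.1.1 k * initial hT (futureSecurity₂ M q τ₀) k ≤ ∑ k, s.1.1 k * w₀ k :=
        Finset.sum_le_sum fun k _ => mul_le_mul_of_nonneg_left (h₀ k) (s.1.2.1 k)
      have h3 : ∑ k, s.1.1 k * -w₀ k = -∑ k, s.1.1 k * w₀ k := by simp
      linarith
    · -- Against every strategy of player 2, the average over `p` is at least that of `w₀`.
      have := le_dualValue₁ hT M hp hq h (fun k => -w₀ k)
      rwa [hneg] at this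
  refine ⟨fun μ' _ => ?_, hzero⟩
  have := le_dualValue₁ hT M hp hq h μ'
  simp only [Set.mem_ofPred_eq, hzero]
  linarith

theorem regret_of_isSecurity₂ [Nonempty K] [Nonempty B] (hT : 0 < T) (M : K → L → A → B → ℝ)
    {p : K → ℝ} (hp : p ∈ stdSimplex ℝ K) {q : L → ℝ} (hq : q ∈ stdSimplex ℝ L)
    {τ : Strategy T L A B B} (hτ : IsSecurity₂ (payoff M p q) τ) {μ : K → ℝ}
    (hμ : ∀ k, μ k = -initial hT (futureSecurity₂ M q τ) k) :
    IsInitialRegret₁ T M p q μ ∧ dualValue₁ T M μ q = 0 ∧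
      IsOptimal₂ hT M p q (plan₂ q τ) (futureSecurity₂ M q τ) := by
  obtain rfl : μ = _ := funext hμ
  have hτ' := (isSecurity₂_iff hT M hp.1 q τ).1 hτ
  obtain ⟨h1, h2⟩ := dualValue₁_eq_zero_and_isInitialRegret₁ hT M hp hq hτ' fun _ => le_rfl
  refine ⟨h1, h2, feasible₂_plan₂ M hq.1 τ, fun y' w' h => ?_⟩
  rw [← plan₂_strategyOfPlan h.1] at h
  exact (hτ' _).trans (Finset.sum_le_sum fun k _ =>
    mul_le_mul_of_nonneg_left (futureSecurity₂_le h ..) (hp.1 k))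

theorem regret_of_isOptimal₂ [Nonempty K] [Nonempty B] (hT : 0 < T) (M : K → L → A → B → ℝ)
    {p : K → ℝ} (hp : p ∈ stdSimplex ℝ K) {q : L → ℝ} (hq : q ∈ stdSimplex ℝ L)
    {y : PlanSpace T L A B B} {w : SecuritySpace T K A B} (h : IsOptimal₂ hT M p q y w) :
    (∃ τ : Strategy T L A B B,
      IsSecurity₂ (payoff M p q) τ ∧ plan₂ q τ = y ∧
      ((∀ k, 0 < p k) → ∀ k, initial hT w k = initial hT (futureSecurity₂ M q τ) k)) ∧
    IsInitialRegret₁ T M p q (fun k => -initial hT w k) ∧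
    dualValue₁ T M (fun k => -initial hT w k) q = 0 := by
  obtain ⟨hf, hopt⟩ := h
  obtain ⟨τ, rfl⟩ : ∃ τ, plan₂ q τ = y := ⟨_, plan₂_strategyOfPlan hf.1⟩
  have hle : ∀ k, initial hT (futureSecurity₂ M q τ) k ≤ initial hT w k := fun k =>
    futureSecurity₂_le hf ..
  have hsum : ∑ k, p k * initial hT (futureSecurity₂ M q τ) k ≤ ∑ k, p k * initial hT w k :=
    Finset.sum_le_sum fun k _ => mul_le_mul_of_nonneg_left (hle k) (hp.1 k)
  have hmin : ∀ τ' : Strategy T L A B B,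
      ∑ k, p k * initial hT w k ≤ ∑ k, p k * initial hT (futureSecurity₂ M q τ') k := fun τ' =>
    hopt _ _ (feasible₂_plan₂ M hq.1 τ')
  refine ⟨⟨τ, (isSecurity₂_iff hT M hp.1 q τ).2 fun τ' => hsum.trans (hmin τ'), rfl,
    fun hpos k => ?_⟩, dualValue₁_eq_zero_and_isInitialRegret₁ hT M hp hq hmin hle⟩
  have heq := (Finset.sum_eq_sum_iff_of_le fun k _ =>
    mul_le_mul_of_nonneg_left (hle k) (hp.1 k)).1 (hsum.antisymm (hmin τ)) k (Finset.mem_univ k)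
  exact (mul_left_cancel₀ (hpos k).ne' heq).symm

end Regret

/-! ### Exchanging the players of a zero-sum game -/

section NegSwap

/-! `g'` is the game `g` in which the players have exchanged their roles. -/

variable {S S' R R' : Type*} {g : S → S' → ℝ} {g' : R → R' → ℝ} {e : S ≃ R'} {e' : S' ≃ R}

theorem isLeast_iff_isGreatest_neg (h : ∀ s t, g s t = -g' (e' t) (e s)) (s : S) (m : ℝ) :
    IsLeast (Set.range fun t => g s t) m ↔ IsGreatest (Set.range fun r => g' r (e s)) (-m) := by
  have : (Set.range fun t => g s t) = -Set.range fun r => g' r (e s) := by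
    ext x
    rw [Set.mem_neg]
    constructor
    · rintro ⟨t, rfl⟩
      exact ⟨e' t, by simp [h]⟩
    · rintro ⟨r, hr⟩
      exact ⟨e'.symm r, by simpa [h] using neg_eq_iff_eq_neg.2 hr⟩
  rw [this]
  simp only [IsLeast, IsGreatest, Set.mem_neg, mem_lowerBounds, mem_upperBounds]
  refine and_congr_right fun _ => ⟨fun H x hx => ?_, fun H x hx => ?_⟩
  · have := H (-x) (by simpa using hx)
    linarith
  · have := H _ hx
    linarith

theorem isMaximin_iff_isMinimax_neg (h : ∀ s t, g s t = -g' (e' t) (e s)) (v : ℝ) :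
    IsMaximin g v ↔ IsMinimax g' (-v) := by
  simp only [IsMaximin, IsMinimax, isLeast_iff_isGreatest_neg h]
  simp only [IsLeast, IsGreatest, mem_lowerBounds, mem_upperBounds, Set.mem_ofPred_eq,
    forall_exists_index]
  refine and_congr ⟨fun ⟨s, hs⟩ => ⟨e s, hs⟩, fun ⟨r, hr⟩ => ⟨e.symm r, by simpa using hr⟩⟩
    ⟨fun H x r hr => ?_, fun H x s hs => ?_⟩
  · have := H (-x) (e.symm r) (by simpa using hr)
    linarith
  · have := H (-x) (e s) hs
    linarith

theorem isSecurity₁_iff_isSecurity₂_neg (h : ∀ s t, g s t = -g' (e' t) (e s)) (s : S) :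
    IsSecurity₁ g s ↔ IsSecurity₂ g' (e s) := by
  simp only [IsSecurity₁, IsSecurity₂, isMaximin_iff_isMinimax_neg h, isLeast_iff_isGreatest_neg h]
  exact ⟨fun ⟨v, hv⟩ => ⟨-v, hv⟩, fun ⟨v, hv⟩ => ⟨-v, by simpa using hv⟩⟩

theorem value_eq_neg (h : ∀ s t, g s t = -g' (e' t) (e s)) {v v' : ℝ} (hv : IsValue g v)
    (hv' : IsValue g' v') : v = -v' :=
  neg_eq_iff_eq_neg.1 (((isMaximin_iff_isMinimax_neg h v).1 hv.1).unique hv'.2)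

end NegSwap

/-! ### The initial regret on player 2's type -/

section Exchange

variable {T : ℕ} {Θ K L A B C : Type*}

/-- The stage payoffs of the game in which the players have exchanged their roles. -/
def exchange (M : K → L → A → B → ℝ) : L → K → B → A → ℝ :=
  fun l k b a => -M k l a b

/-- `TypeStrategy.flip` as an equivalence. -/
def TypeStrategy.flipEquiv [Fintype C] : TypeStrategy T A B C ≃ TypeStrategy T B A C where
  toFun := TypeStrategy.flip
  invFun := TypeStrategy.flip
  left_inv _ := rfl
  right_inv _ := rfl

/-- `Strategy.flip` as an equivalence. -/
def Strategy.flipEquiv [Fintype C] : Strategy T Θ A B C ≃ Strategy T Θ B A C where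
  toFun := Strategy.flip
  invFun := Strategy.flip
  left_inv _ := rfl
  right_inv _ := rfl

/-- The future security payoffs seen from the game in which the players have exchanged their
roles. -/
def negFlip (u : SecuritySpace T Θ A B) : SecuritySpace T Θ B A :=
  fun n θ hB hA => -u n θ hA hB

theorem negFlip_negFlip (u : SecuritySpace T Θ A B) : negFlip (negFlip u) = u := by
  funext n θ hA hB
  simp [negFlip]

theorem initial_negFlip (hT : 0 < T) (u : SecuritySpace T Θ A B) (θ : Θ) :
    initial hT (negFlip u) θ = -initial hT u θ :=
  rfl

theorem next_negFlip (u : SecuritySpace T Θ A B) (n : Fin T) (θ : Θ) (hA : Fin (n + 1) → A)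
    (hB : Fin (n + 1) → B) : next (negFlip u) n θ hB hA = -next u n θ hA hB := by
  unfold next
  split_ifs
  · rfl
  · simp

variable [Fintype A]

theorem flipPlan_mem_planSet₂ {p : K → ℝ} {x : PlanSpace T K A B A} :
    flipPlan x ∈ planSet₂ p ↔ x ∈ planSet₁ p :=
  ⟨fun h => ⟨fun n k hA hB a => h.1 n k hB hA a, h.2.1, fun n hn k hA hB a b =>
    h.2.2 n hn k hB hA b a⟩, fun h => ⟨fun n k hB hA a => h.1 n k hA hB a, h.2.1,
    fun n hn k hB hA b a => h.2.2 n hn k hA hB a b⟩⟩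

variable [Fintype K]

theorem feasible₂_exchange {M : K → L → A → B → ℝ} {p : K → ℝ} {x : PlanSpace T K A B A}
    {u : SecuritySpace T L A B} :
    Feasible₂ (exchange M) p (flipPlan x) (negFlip u) ↔ Feasible₁ M p x u := by
  refine and_congr flipPlan_mem_planSet₂ (forall_congr' fun n => forall_congr' fun l => ?_)
  rw [forall_comm]
  refine forall_congr' fun hA => forall_congr' fun hB => forall_congr' fun b => ?_
  simp only [next_negFlip]
  simp only [negFlip, exchange, flipPlan, LinearMap.coe_mk, AddHom.coe_mk, neg_mul,
    Finset.sum_neg_distrib, ← neg_add, neg_le_neg_iff]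

theorem isOptimal₂_exchange [Fintype L] {hT : 0 < T} {M : K → L → A → B → ℝ} {p : K → ℝ} {q : L → ℝ}
    {x : PlanSpace T K A B A} {u : SecuritySpace T L A B} :
    IsOptimal₂ hT (exchange M) q p (flipPlan x) (negFlip u) ↔ IsOptimal₁ hT M p q x u := by
  refine and_congr feasible₂_exchange ⟨fun h x' u' hf => ?_, fun h y w hf => ?_⟩
  · have := h _ _ (feasible₂_exchange.2 hf)
    simpa [initial_negFlip] using this
  · obtain ⟨x', rfl⟩ : ∃ x', flipPlan x' = y := ⟨flipPlan y, rfl⟩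
    obtain ⟨u', rfl⟩ : ∃ u', negFlip u' = w := ⟨negFlip w, negFlip_negFlip w⟩
    simpa [initial_negFlip] using h _ _ (feasible₂_exchange.1 hf)

variable [Fintype B]

theorem futureProb_flip (n : ℕ) (s : TypeStrategy T A B A) (t : TypeStrategy T A B B)
    (a : Fin T → A) (b : Fin T → B) :
    futureProb n t.flip s.flip b a = futureProb n s t a b :=
  Finset.prod_congr rfl fun _ _ => mul_comm _ _

theorem futurePayoff_flip (m : A → B → ℝ) (n : Fin T) (hA : Fin n → A) (hB : Fin n → B)
    (s : TypeStrategy T A B A) (t : TypeStrategy T A B B) :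
    futurePayoff (fun b a => -m a b) n hB hA t.flip s.flip = -futurePayoff m n hA hB s t := by
  unfold futurePayoff
  rw [Finset.sum_comm]
  simp only [futureProb_flip, ← Finset.sum_neg_distrib]
  refine Finset.sum_congr rfl fun a _ => Finset.sum_congr rfl fun b _ => ?_
  by_cases h₁ : pre a n n.2.le = hA <;> by_cases h₂ : pre b n n.2.le = hB <;> simp [h₁, h₂]

/-- Exchanging the roles turns the minimum that defines `futureSecurity₁` into the maximum that
defines `futureSecurity₂`. -/
theorem futureSecurity₂_exchange (M : K → L → A → B → ℝ) (p : K → ℝ)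
    (σ : Strategy T K A B A) :
    futureSecurity₂ (exchange M) p σ.flip = negFlip (futureSecurity₁ M p σ) := by
  funext n l hB hA
  have h : ∀ t : TypeStrategy T A B B,
      ∑ k, reach₂ p σ.flip n k hB hA * futurePayoff (exchange M l k) n hB hA t.flip (σ.flip k) =
      -∑ k, reach₁ p σ n k hA hB * futurePayoff (M k l) n hA hB (σ k) t := by
    intro t
    rw [← Finset.sum_neg_distrib]
    refine Finset.sum_congr rfl fun k _ => ?_
    rw [← mul_neg, ← futurePayoff_flip]
    rfl
  simp only [futureSecurity₂, negFlip, futureSecurity₁]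
  rw [← TypeStrategy.flipEquiv.iSup_comp, iInf, Real.sInf_def, neg_neg, ← Set.image_neg_eq_neg,
    ← Set.range_comp]
  exact congrArg iSup (funext h)

variable [Fintype L]

theorem expectation_flip (p : K → ℝ) (q : L → ℝ) (σ : Strategy T K A B A)
    (τ : Strategy T L A B B) (f : K → L → (Fin T → A) → (Fin T → B) → ℝ) :
    expectation q p τ.flip σ.flip (fun l k b a => f k l a b) = expectation p q σ τ f := by
  unfold expectation
  rw [Finset.sum_comm]
  refine Finset.sum_congr rfl fun k _ => Finset.sum_congr rfl fun l _ => ?_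
  rw [Finset.sum_comm]
  refine Finset.sum_congr rfl fun a _ => Finset.sum_congr rfl fun b _ => ?_
  simp only [playProb, Strategy.flip, futureProb_flip, mul_comm (q l)]

theorem expectation_neg (p : K → ℝ) (q : L → ℝ) (σ : Strategy T K A B A)
    (τ : Strategy T L A B B) (f : K → L → (Fin T → A) → (Fin T → B) → ℝ) :
    expectation p q σ τ (fun k l a b => -f k l a b) = -expectation p q σ τ f := by
  simp only [expectation, mul_neg, Finset.sum_neg_distrib]

theorem payoff_exchange (M : K → L → A → B → ℝ) (p : K → ℝ) (q : L → ℝ)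
    (σ : Strategy T K A B A) (τ : Strategy T L A B B) :
    payoff M p q σ τ = -payoff (exchange M) q p τ.flip σ.flip := by
  rw [payoff, payoff, ← expectation_neg, ← expectation_flip]
  simp [exchange]

theorem dualPayoff₂_exchange (M : K → L → A → B → ℝ) (p : K → ℝ) (ν : L → ℝ)
    (σ : Strategy T K A B A) (s : stdSimplex ℝ L × Strategy T L A B B) :
    dualPayoff₂ M p ν σ s =
      -dualPayoff₁ (exchange M) (fun l => -ν l) p (s.1, s.2.flip) σ.flip := by
  rw [dualPayoff₁, dualPayoff₂, ← expectation_neg, ← expectation_flip]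
  simp [exchange, add_comm]

variable [Nonempty A] [Nonempty B] [Nonempty L]

/-- The type 2 dual game is a type 1 dual game with the roles exchanged. The equality of the numbers
`dualValue₂` and `dualValue₁` rests on both games having values. -/
theorem dualValue₂_exchange (hT : 0 < T) (M : K → L → A → B → ℝ) {p : K → ℝ} (hp : ∀ k, 0 ≤ p k)
    (ν : L → ℝ) : dualValue₂ T M p ν = -dualValue₁ T (exchange M) (fun l => -ν l) p :=
  value_eq_neg (e := Strategy.flipEquiv) (e' := (Equiv.refl _).prodCongr Strategy.flipEquiv)
    (dualPayoff₂_exchange M p ν) (isValue_dualPayoff₂ hT M hp ν)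
    (isValue_dualPayoff₁ hT (exchange M) _ hp)

theorem isInitialRegret₂_of_exchange (hT : 0 < T) {M : K → L → A → B → ℝ} {p : K → ℝ}
    (hp : ∀ k, 0 ≤ p k) {q : L → ℝ} {ν : L → ℝ}
    (h : IsInitialRegret₁ T (exchange M) q p fun l => -ν l) : IsInitialRegret₂ T M p q ν := by
  intro ν' _
  have := h (Set.mem_univ fun l => -ν' l)
  simp only [Set.mem_ofPred_eq, mul_neg, Finset.sum_neg_distrib] at this
  simp only [Set.mem_ofPred_eq, dualValue₂_exchange hT M hp]
  linarith

theorem regret_of_isSecurity₁ (hT : 0 < T) (M : K → L → A → B → ℝ)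
    {p : K → ℝ} (hp : p ∈ stdSimplex ℝ K) {q : L → ℝ} (hq : q ∈ stdSimplex ℝ L)
    {σ : Strategy T K A B A} (hσ : IsSecurity₁ (payoff M p q) σ) {ν : L → ℝ}
    (hν : ∀ l, ν l = -initial hT (futureSecurity₁ M p σ) l) :
    IsInitialRegret₂ T M p q ν ∧ dualValue₂ T M p ν = 0 ∧
      IsOptimal₁ hT M p q (plan₁ p σ) (futureSecurity₁ M p σ) := by
  have hσ' : IsSecurity₂ (payoff (exchange M) q p) σ.flip :=
    (isSecurity₁_iff_isSecurity₂_neg (e := Strategy.flipEquiv) (e' := Strategy.flipEquiv)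
      (payoff_exchange M p q) σ).1 hσ
  obtain ⟨h1, h2, h3⟩ := regret_of_isSecurity₂ hT (exchange M) hq hp hσ' (μ := fun l => -ν l)
    fun l => by rw [futureSecurity₂_exchange, initial_negFlip, hν]
  refine ⟨isInitialRegret₂_of_exchange hT hp.1 h1, ?_, ?_⟩
  · rw [dualValue₂_exchange hT M hp.1, h2, neg_zero]
  · rw [futureSecurity₂_exchange] at h3
    exact isOptimal₂_exchange.1 h3

theorem regret_of_isOptimal₁ (hT : 0 < T) (M : K → L → A → B → ℝ)
    {p : K → ℝ} (hp : p ∈ stdSimplex ℝ K) {q : L → ℝ} (hq : q ∈ stdSimplex ℝ L)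
    {x : PlanSpace T K A B A} {u : SecuritySpace T L A B} (h : IsOptimal₁ hT M p q x u) :
    (∃ σ : Strategy T K A B A,
      IsSecurity₁ (payoff M p q) σ ∧ plan₁ p σ = x ∧
      ((∀ l, 0 < q l) → ∀ l, initial hT u l = initial hT (futureSecurity₁ M p σ) l)) ∧
    IsInitialRegret₂ T M p q (fun l => -initial hT u l) ∧
    dualValue₂ T M p (fun l => -initial hT u l) = 0 := by
  obtain ⟨⟨τ, h1, h2, h3⟩, h4, h5⟩ :=
    regret_of_isOptimal₂ hT (exchange M) hq hp (isOptimal₂_exchange.2 h)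
  obtain ⟨σ, rfl⟩ : ∃ σ, Strategy.flip σ = τ := ⟨τ.flip, rfl⟩
  simp only [initial_negFlip] at h3 h4 h5
  refine ⟨⟨σ, ?_, ?_, fun hpos l => ?_⟩, isInitialRegret₂_of_exchange hT hp.1 h4, ?_⟩
  · exact (isSecurity₁_iff_isSecurity₂_neg (e := Strategy.flipEquiv) (e' := Strategy.flipEquiv)
      (payoff_exchange M p q) σ).2 h1
  · rw [plan₁_eq_flipPlan, h2]
    rfl
  · have := h3 hpos l
    rwa [futureSecurity₂_exchange, initial_negFlip, neg_inj] at this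
  · rw [dualValue₂_exchange hT M hp.1, h5, neg_zero]

end Exchange

end BayesGame

/-! ### Initial regrets and the linear programs -/

theorem mainTheorem2 {K L A B : Type*} [Fintype K] [Fintype L] [Fintype A] [Fintype B]
    [Nonempty K] [Nonempty L] [Nonempty A] [Nonempty B]
    (M : K → L → A → B → ℝ) (T : ℕ) (hT : 0 < T)
    (p : K → ℝ) (hp : p ∈ stdSimplex ℝ K) (q : L → ℝ) (hq : q ∈ stdSimplex ℝ L) :
    -- the primal and dual games have values
    BayesGame.IsValue (BayesGame.payoff (T := T) M p q)
      (BayesGame.gameValue (BayesGame.payoff (T := T) M p q)) ∧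
    (∀ μ : K → ℝ, BayesGame.IsValue (BayesGame.dualPayoff₁ (T := T) M μ q)
      (BayesGame.dualValue₁ T M μ q)) ∧
    (∀ ν : L → ℝ, BayesGame.IsValue (BayesGame.dualPayoff₂ (T := T) M p ν)
      (BayesGame.dualValue₂ T M p ν)) ∧
    -- the regret on player 1's type, from any security strategy of player 2
    (∀ τ : BayesGame.Strategy T L A B B,
      BayesGame.IsSecurity₂ (BayesGame.payoff M p q) τ →
      ∀ μ : K → ℝ,
        (∀ k, μ k = -BayesGame.initial hT (BayesGame.futureSecurity₂ M q τ) k) →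
        BayesGame.IsInitialRegret₁ T M p q μ ∧
        BayesGame.dualValue₁ T M μ q = 0 ∧
        BayesGame.IsOptimal₂ hT M p q (BayesGame.plan₂ q τ)
          (BayesGame.futureSecurity₂ M q τ)) ∧
    -- the regret on player 1's type, from any optimal solution of player 2's linear program
    (∀ (y : BayesGame.PlanSpace T L A B B) (w : BayesGame.SecuritySpace T K A B),
      BayesGame.IsOptimal₂ hT M p q y w →
      (∃ τ : BayesGame.Strategy T L A B B,
        BayesGame.IsSecurity₂ (BayesGame.payoff M p q) τ ∧ BayesGame.plan₂ q τ = y ∧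
        ((∀ k, 0 < p k) → ∀ k, BayesGame.initial hT w k =
          BayesGame.initial hT (BayesGame.futureSecurity₂ M q τ) k)) ∧
      BayesGame.IsInitialRegret₁ T M p q (fun k => -BayesGame.initial hT w k) ∧
      BayesGame.dualValue₁ T M (fun k => -BayesGame.initial hT w k) q = 0) ∧
    -- the regret on player 2's type, from any security strategy of player 1
    (∀ σ : BayesGame.Strategy T K A B A,
      BayesGame.IsSecurity₁ (BayesGame.payoff M p q) σ →
      ∀ ν : L → ℝ,
        (∀ l, ν l = -BayesGame.initial hT (BayesGame.futureSecurity₁ M p σ) l) →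
        BayesGame.IsInitialRegret₂ T M p q ν ∧
        BayesGame.dualValue₂ T M p ν = 0 ∧
        BayesGame.IsOptimal₁ hT M p q (BayesGame.plan₁ p σ)
          (BayesGame.futureSecurity₁ M p σ)) ∧
    -- the regret on player 2's type, from any optimal solution of player 1's linear program
    (∀ (x : BayesGame.PlanSpace T K A B A) (u : BayesGame.SecuritySpace T L A B),
      BayesGame.IsOptimal₁ hT M p q x u →
      (∃ σ : BayesGame.Strategy T K A B A,
        BayesGame.IsSecurity₁ (BayesGame.payoff M p q) σ ∧ BayesGame.plan₁ p σ = x ∧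
        ((∀ l, 0 < q l) → ∀ l, BayesGame.initial hT u l =
          BayesGame.initial hT (BayesGame.futureSecurity₁ M p σ) l)) ∧
      BayesGame.IsInitialRegret₂ T M p q (fun l => -BayesGame.initial hT u l) ∧
      BayesGame.dualValue₂ T M p (fun l => -BayesGame.initial hT u l) = 0) := by
  open BayesGame in
  exact ⟨isValue_payoff M hp.1 hq.1, fun μ => isValue_dualPayoff₁ hT M μ hq.1,
    fun ν => isValue_dualPayoff₂ hT M hp.1 ν,
    fun _ hτ _ hμ => regret_of_isSecurity₂ hT M hp hq hτ hμ,
    fun _ _ h => regret_of_isOptimal₂ hT M hp hq h,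
    fun _ hσ _ hν => regret_of_isSecurity₁ hT M hp hq hσ hν,
    fun _ _ h => regret_of_isOptimal₁ hT M hp hq h⟩
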